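/- **Theorem.** Let $\mathbf F\in\{\mathbf R,\mathbf C\}$, let $\mathrm U(d,\mathbf F)$ denote $\mathrm O(d)$ if $\mathbf F=\mathbf R$ and $\mathrm U(d)$ if $\mathbf F=\mathbf C$, and let it act on the set $\mathrm{Gr}(r,\mathbf F^d)$ of $r$-dimensional subspaces of $\mathbf F^d$ by $g\cdot V=\{gx:x\in V\}$ and diagonally on $(\mathrm{Gr}(r,\mathbf F^d))^n$, where $n,d\ge1$ and $r\ge0$. For matrices $A=(A_1,\dots,A_n)$ in $\mathbf F^{d\times d}$ let $w(A)$ denote the evaluation at $A$ of a word $w$ in noncommuting variables $x_1,\dots,x_n$ (the empty word gives the identity matrix). Define a list of words $w_1,\dots,w_m$ as follows. Start with the list that contains only the empty word. In one pass over a list $w_1,\dots,w_{m_{\rm old}}$, run through the pairs $(i,j)\in[n]\times[m_{\rm old}]$ in lexicographic order, and append the word $x_iw_j$ to the list whenever $A_iw_j(A)$ is not in the linear span of the evaluations at $A$ of all words that are in the list at that moment. Repeat passes until a pass appends no word. (This happens after finitely many passes.) For $V=(V_1,\dots,V_n)\in(\mathrm{Gr}(r,\mathbf F^d))^n$ let $A_i$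 be the matrix of the orthogonal projection of $\mathbf F^d$ onto $V_i$, let $w_1,\dots,w_m$ be the resulting words, put $E_j=w_j(A)$, and let $f(V)$ consist of the words $(w_j)_{j\in[m]}$ and the traces $$\operatorname{tr}(E_i^*E_j),\qquad \operatorname{tr}(E_i^*E_jE_k),\qquad \operatorname{tr}(E_i^*A_l)\qquad(i,j,k\in[m],\ l\in[n]).$$ Then $f$ is an injective invariant for $(\mathrm{Gr}(r,\mathbf F^d))^n$ modulo $\mathrm U(d,\mathbf F)$: for all $V,W$ one has $f(V)=f(W)$ if and only if $W=g\cdot V$ for some $g\in\mathrm U(d,\mathbf F)$. Moreover, there are a single deterministic program and an absolute constant $C$ such that, for all such $\mathbf F,n,d,r$ and all $V$, the program, given $n,d,r$ and the entries of $A_1,\dots,A_n$, outputs $f(V)$ after at most $C\,(nd^8+r^2d^9)$ operations. Here a program is a finite text that works on arrays of natural numbers and of elements of $\mathbf F$; each arithmetic operation of $\mathbf F$, complex conjugation, test whether an element of $\mathbf F$ is zero, addition, subtraction or comparison of natural numbers, array access, and loop step counts as one operation. -/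

import Mathlib

/-! ### The Grassmannian and the action of the unitary (orthogonal) group -/

/-- `Gr 𝕜 r d` is the set of `r`-dimensional subspaces of `𝕜 ^ d`. -/
@[ext]
structure Gr (𝕜 : Type*) [RCLike 𝕜] (r d : ℕ) where
  space : Submodule 𝕜 (EuclideanSpace 𝕜 (Fin d))
  finrank_space : Module.finrank 𝕜 space = r

/-- The natural action `g • V = {g x | x ∈ V}` on subspaces.
`Matrix.unitaryGroup (Fin d) 𝕜` is `O(d)` for `𝕜 = ℝ` and `U(d)` for `𝕜 = ℂ`. -/
noncomputable instance Gr.instMulAction {𝕜 : Type*} [RCLike 𝕜] {r d : ℕ} :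
    MulAction (Matrix.unitaryGroup (Fin d) 𝕜) (Gr 𝕜 r d) where
  smul g V :=
    { space := V.space.map (Matrix.toEuclideanLin (g : Matrix (Fin d) (Fin d) 𝕜))
      finrank_space := by
        have hinj : Function.Injective
            (Matrix.toEuclideanLin (g : Matrix (Fin d) (Fin d) 𝕜)) := by
          intro x y hxy
          have h : ∀ z : EuclideanSpace 𝕜 (Fin d),
              Matrix.toEuclideanLin (star (g : Matrix (Fin d) (Fin d) 𝕜))
                (Matrix.toEuclideanLin (g : Matrix (Fin d) (Fin d) 𝕜) z) = z := by
            intro z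
            simp [Matrix.toLpLin_apply, Matrix.mulVec_mulVec]
          rw [← h x, hxy, h y]
        exact (Submodule.equivMapOfInjective _ hinj V.space).finrank_eq.symm.trans
          V.finrank_space }
  one_smul V := by
    apply Gr.ext
    change V.space.map (Matrix.toEuclideanLin (1 : Matrix (Fin d) (Fin d) 𝕜)) = V.space
    ext x
    simp
  mul_smul g h V := by
    apply Gr.ext
    change V.space.map (Matrix.toEuclideanLin
        ((g : Matrix (Fin d) (Fin d) 𝕜) * (h : Matrix (Fin d) (Fin d) 𝕜))) =
      (V.space.map (Matrix.toEuclideanLin (h : Matrix (Fin d) (Fin d) 𝕜))).map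
        (Matrix.toEuclideanLin (g : Matrix (Fin d) (Fin d) 𝕜))
    ext x
    simp [Matrix.toLpLin_apply, Matrix.mulVec_mulVec]

/-- The `d × d` matrix of the orthogonal projection of `𝕜 ^ d` onto `V`. -/
noncomputable def Gr.projMatrix {𝕜 : Type*} [RCLike 𝕜] {r d : ℕ} (V : Gr 𝕜 r d) :
    Matrix (Fin d) (Fin d) 𝕜 :=
  (Matrix.toEuclideanCLM (n := Fin d) (𝕜 := 𝕜)).symm V.space.starProjection

/-- `f` is an injective invariant for the `G`-set `X`: two points have the same value
exactly if they lie in the same orbit. -/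
def IsInjectiveInvariant (G : Type*) {X S : Type*} [Group G] [MulAction G X]
    (f : X → S) : Prop :=
  ∀ x y : X, f x = f y ↔ ∃ g : G, g • x = y

/-! ### Words and the canonical basis of a finitely generated matrix algebra -/

/-- Evaluation of a word in noncommuting variables `x_0, …, x_{n-1}` at the matrices `A`;
the word of length zero evaluates to the identity matrix. -/
def evalWord {𝕜 : Type*} [RCLike 𝕜] {n d : ℕ} (A : Fin n → Matrix (Fin d) (Fin d) 𝕜)
    (w : List (Fin n)) : Matrix (Fin d) (Fin d) 𝕜 :=
  (w.map A).prod

/-- The span of the evaluations of the words in a list. -/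
def wordSpan {𝕜 : Type*} [RCLike 𝕜] {n d : ℕ} (A : Fin n → Matrix (Fin d) (Fin d) 𝕜)
    (ws : List (List (Fin n))) : Submodule 𝕜 (Matrix (Fin d) (Fin d) 𝕜) :=
  Submodule.span 𝕜 {M | ∃ w ∈ ws, M = evalWord A w}

open Classical in
/-- Append the word `w` to the list `ws` if its evaluation is linearly independent of the
evaluations of the words that are in the list already. -/
noncomputable def tryWord {𝕜 : Type*} [RCLike 𝕜] {n d : ℕ}
    (A : Fin n → Matrix (Fin d) (Fin d) 𝕜) (ws : List (List (Fin n))) (w : List (Fin n)) :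
    List (List (Fin n)) :=
  if evalWord A w ∈ wordSpan A ws then ws else ws ++ [w]

/-- The body of the while loop: try the words `x_i w_j` one after the other, for `i ∈ [n]` and
`j ∈ [m_old]` in lexicographic order, where `w_1, …, w_{m_old}` are the words
that were in the list when the body was entered. -/
noncomputable def basisPass {𝕜 : Type*} [RCLike 𝕜] {n d : ℕ}
    (A : Fin n → Matrix (Fin d) (Fin d) 𝕜) (ws : List (List (Fin n))) :
    List (List (Fin n)) :=
  ((List.finRange n).flatMap fun i => ws.map fun w => i :: w).foldl (tryWord A) ws

/-- If a pass appends words to the list, then the span of the evaluations grows. -/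
theorem foldl_tryWord_eq_or_lt {𝕜 : Type*} [RCLike 𝕜] {n d : ℕ}
    (A : Fin n → Matrix (Fin d) (Fin d) 𝕜) (cs ws : List (List (Fin n))) :
    cs.foldl (tryWord A) ws = ws ∨ wordSpan A ws < wordSpan A (cs.foldl (tryWord A) ws) := by
  induction cs generalizing ws with
  | nil => exact Or.inl rfl
  | cons c cs ih =>
    rw [List.foldl_cons]
    by_cases h : evalWord A c ∈ wordSpan A ws
    · have : tryWord A ws c = ws := if_pos h
      rw [this]
      exact ih ws
    · have h1 : tryWord A ws c = ws ++ [c] := if_neg h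
      rw [h1]
      have h2 : wordSpan A ws < wordSpan A (ws ++ [c]) := by
        refine lt_of_le_of_ne (Submodule.span_mono ?_) ?_
        · rintro M ⟨w, hw, rfl⟩
          exact ⟨w, List.mem_append_left _ hw, rfl⟩
        · intro he
          apply h
          rw [he]
          exact Submodule.subset_span ⟨c, by simp, rfl⟩
      rcases ih (ws ++ [c]) with h3 | h3
      · right
        rw [h3]
        exact h2
      · exact Or.inr (h2.trans h3)

/-- The while loop: run passes as long as the list gets longer. -/
noncomputable def basisLoop {𝕜 : Type*} [RCLike 𝕜] {n d : ℕ}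
    (A : Fin n → Matrix (Fin d) (Fin d) 𝕜) (ws : List (List (Fin n))) :
    List (List (Fin n)) :=
  if ws.length < (basisPass A ws).length then basisLoop A (basisPass A ws)
  else basisPass A ws
termination_by d * d - Module.finrank 𝕜 (wordSpan A ws)
decreasing_by
  rename_i h
  have hlt : wordSpan A ws < wordSpan A (basisPass A ws) := by
    rcases foldl_tryWord_eq_or_lt A
        ((List.finRange n).flatMap fun i => ws.map fun w => i :: w) ws with h1 | h1
    · have h2 : basisPass A ws = ws := h1
      rw [h2] at h
      exact absurd h (lt_irrefl _)
    · exact h1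
  have h3 := Submodule.finrank_lt_finrank_of_lt hlt
  have h4 : Module.finrank 𝕜 (wordSpan A (basisPass A ws)) ≤ d * d := by
    have := Submodule.finrank_le (wordSpan A (basisPass A ws))
    simpa [Module.finrank_matrix] using this
  omega

/-- The words that the algorithm returns on the input `A`: it starts from the list that holds
only the word of length zero. -/
noncomputable def basisWords {𝕜 : Type*} [RCLike 𝕜] {n d : ℕ}
    (A : Fin n → Matrix (Fin d) (Fin d) 𝕜) : List (List (Fin n)) :=
  basisLoop A [[]]

/-! ### The invariant -/

/-- A finite list of words together with three families of scalars that it indexes. -/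
structure TraceData (𝕜 : Type*) (n : ℕ) where
  words : List (List (Fin n))
  pair : Fin words.length → Fin words.length → 𝕜
  triple : Fin words.length → Fin words.length → Fin words.length → 𝕜
  gen : Fin words.length → Fin n → 𝕜

/-- The words `w_j` that the algorithm returns on `A`, together with the traces
`tr(E_i^* E_j)`, `tr(E_i^* E_j E_k)` and `tr(E_i^* A_j)`, where `E_j` is the evaluation of
`w_j` at `A`. -/
noncomputable def traceData {𝕜 : Type*} [RCLike 𝕜] {n d : ℕ}
    (A : Fin n → Matrix (Fin d) (Fin d) 𝕜) : TraceData 𝕜 n where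
  words := basisWords A
  pair i j :=
    ((evalWord A ((basisWords A).get i)).conjTranspose *
      evalWord A ((basisWords A).get j)).trace
  triple i j k :=
    ((evalWord A ((basisWords A).get i)).conjTranspose *
      evalWord A ((basisWords A).get j) * evalWord A ((basisWords A).get k)).trace
  gen i j := ((evalWord A ((basisWords A).get i)).conjTranspose * A j).trace

/-- The invariant of a tuple of subspaces: the trace data of its orthogonal projections. -/
noncomputable def projInvariant {𝕜 : Type*} [RCLike 𝕜] {n r d : ℕ} (V : Fin n → Gr 𝕜 r d) :
    TraceData 𝕜 n :=
  traceData fun i => (V i).projMatrix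

/-! ### A machine model that counts operations

A program is a finite text. It works on three-dimensional arrays of natural numbers (for
counters, indices and words) and on three-dimensional arrays of elements of `𝕜`, and names
its arrays by numerals. Its operations on `𝕜` are the constants `0` and `1`, the field
operations, conjugation, and the test whether an element is zero. Every such operation, every
operation on natural numbers, every access to an array, every test and every round of a loop
costs one unit. Only bounded loops are available, so that every program halts. -/

/-- The memory: entry `(i, j, l)` of array number `k` of each of the two sorts. -/
structure Store (𝕜 : Type*) where
  nat : ℕ → ℕ → ℕ → ℕ → ℕ
  fld : ℕ → ℕ → ℕ → ℕ → 𝕜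

/-- Write `v` into entry `(i, j, l)` of array number `k` of natural numbers. -/
def Store.setNat {𝕜 : Type*} (s : Store 𝕜) (k i j l v : ℕ) : Store 𝕜 where
  nat k' i' j' l' := if k' = k ∧ i' = i ∧ j' = j ∧ l' = l then v else s.nat k' i' j' l'
  fld := s.fld

/-- Write `v` into entry `(i, j, l)` of array number `k` of elements of `𝕜`. -/
def Store.setFld {𝕜 : Type*} (s : Store 𝕜) (k i j l : ℕ) (v : 𝕜) : Store 𝕜 where
  nat := s.nat
  fld k' i' j' l' := if k' = k ∧ i' = i ∧ j' = j ∧ l' = l then v else s.fld k' i' j' l'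

/-- Expressions for natural numbers. -/
inductive NExp where
  | const (c : ℕ)
  | get (k : ℕ) (i j l : NExp)
  | add (a b : NExp)
  | sub (a b : NExp)

/-- The value of an expression; `sub` is truncated subtraction. -/
def NExp.eval {𝕜 : Type*} (s : Store 𝕜) : NExp → ℕ
  | const c => c
  | get k i j l => s.nat k (i.eval s) (j.eval s) (l.eval s)
  | add a b => a.eval s + b.eval s
  | sub a b => a.eval s - b.eval s

/-- The number of operations in an expression. -/
def NExp.cost : NExp → ℕ
  | const _ => 1
  | get _ i j l => 1 + i.cost + j.cost + l.cost
  | add a b => 1 + a.cost + b.cost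
  | sub a b => 1 + a.cost + b.cost

/-- Expressions for elements of `𝕜`. -/
inductive FExp where
  | zero
  | one
  | get (k : ℕ) (i j l : NExp)
  | add (a b : FExp)
  | sub (a b : FExp)
  | mul (a b : FExp)
  | div (a b : FExp)
  | conj (a : FExp)

/-- The value of an expression; a quotient with denominator `0` has the value `0`. -/
noncomputable def FExp.eval {𝕜 : Type*} [RCLike 𝕜] (s : Store 𝕜) : FExp → 𝕜
  | zero => 0
  | one => 1
  | get k i j l => s.fld k (i.eval s) (j.eval s) (l.eval s)
  | add a b => a.eval s + b.eval s
  | sub a b => a.eval s - b.eval s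
  | mul a b => a.eval s * b.eval s
  | div a b => a.eval s / b.eval s
  | conj a => star (a.eval s)

/-- The number of operations in an expression. -/
def FExp.cost : FExp → ℕ
  | zero => 1
  | one => 1
  | get _ i j l => 1 + i.cost + j.cost + l.cost
  | add a b => 1 + a.cost + b.cost
  | sub a b => 1 + a.cost + b.cost
  | mul a b => 1 + a.cost + b.cost
  | div a b => 1 + a.cost + b.cost
  | conj a => 1 + a.cost

/-- Programs. -/
inductive Prog where
  /-- do nothing -/
  | skip
  /-- first `p`, then `q` -/
  | seq (p q : Prog)
  /-- write the value of `e` into entry `(i, j, l)` of array `k` of natural numbers -/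
  | setNat (k : ℕ) (i j l : NExp) (e : NExp)
  /-- write the value of `e` into entry `(i, j, l)` of array `k` of elements of `𝕜` -/
  | setFld (k : ℕ) (i j l : NExp) (e : FExp)
  /-- `p` if `a < b`, otherwise `q` -/
  | ifLt (a b : NExp) (p q : Prog)
  /-- `p` if `e = 0`, otherwise `q` -/
  | ifZero (e : FExp) (p q : Prog)
  /-- `p` for `t = 0, …, N - 1`, where `N` is the value of `e` at the start; the counter `t` is
  put into entry `(0, 0, 0)` of array `k` of natural numbers before each round -/
  | loop (k : ℕ) (e : NExp) (p : Prog)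

/-- Run `f 0`, …, `f (N - 1)` one after the other and add up the costs, with one unit
for each round. -/
def runRounds {σ : Type*} (f : ℕ → σ → σ × ℕ) (s : σ) : ℕ → σ × ℕ
  | 0 => (s, 0)
  | N + 1 => ((f N (runRounds f s N).1).1,
      (runRounds f s N).2 + (f N (runRounds f s N).1).2 + 1)

open Classical in
/-- The memory after a run of a program, and the number of operations that the run costs. -/
noncomputable def Prog.run {𝕜 : Type*} [RCLike 𝕜] : Prog → Store 𝕜 → Store 𝕜 × ℕ
  | skip, s => (s, 0)
  | seq p q, s => ((q.run (p.run s).1).1, (p.run s).2 + (q.run (p.run s).1).2)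
  | setNat k i j l e, s => (s.setNat k (i.eval s) (j.eval s) (l.eval s) (e.eval s),
      1 + i.cost + j.cost + l.cost + e.cost)
  | setFld k i j l e, s => (s.setFld k (i.eval s) (j.eval s) (l.eval s) (e.eval s),
      1 + i.cost + j.cost + l.cost + e.cost)
  | ifLt a b p q, s =>
      if a.eval s < b.eval s then ((p.run s).1, 1 + a.cost + b.cost + (p.run s).2)
      else ((q.run s).1, 1 + a.cost + b.cost + (q.run s).2)
  | ifZero e p q, s =>
      if e.eval s = 0 then ((p.run s).1, 1 + e.cost + (p.run s).2)
      else ((q.run s).1, 1 + e.cost + (q.run s).2)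
  | loop k e p, s =>
      ((runRounds (fun t s' => p.run (s'.setNat k 0 0 0 t)) s (e.eval s)).1,
        1 + e.cost + (runRounds (fun t s' => p.run (s'.setNat k 0 0 0 t)) s (e.eval s)).2)

/-- The memory at the start: array `0` of natural numbers holds `n`, `d`, `r`, array `0` of
elements of `𝕜` holds the entries of the matrices, and all else is zero. -/
def inputStore {𝕜 : Type*} [RCLike 𝕜] {n d : ℕ} (r : ℕ)
    (A : Fin n → Matrix (Fin d) (Fin d) 𝕜) : Store 𝕜 where
  nat k i j l :=
    if k = 0 ∧ j = 0 ∧ l = 0 then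
      (if i = 0 then n else if i = 1 then d else if i = 2 then r else 0)
    else 0
  fld k i a b :=
    if h : k = 0 ∧ i < n ∧ a < d ∧ b < d then
      A ⟨i, h.2.1⟩ ⟨a, h.2.2.1⟩ ⟨b, h.2.2.2⟩
    else 0

/-- The memory `s` holds the trace data `t` in its output arrays: the number of words, their
lengths and their letters in the arrays `1`, `2`, `3` of natural numbers, and the three families
of scalars in the arrays `1`, `2`, `3` of elements of `𝕜`. -/
structure Store.Holds {𝕜 : Type*} {n : ℕ} (s : Store 𝕜) (t : TraceData 𝕜 n) : Prop where
  count : s.nat 1 0 0 0 = t.words.length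
  length : ∀ j : Fin t.words.length, s.nat 2 j 0 0 = (t.words.get j).length
  letter : ∀ (j : Fin t.words.length) (p : Fin (t.words.get j).length),
    s.nat 3 j p 0 = ((t.words.get j).get p : ℕ)
  pair : ∀ i j : Fin t.words.length, s.fld 1 i j 0 = t.pair i j
  triple : ∀ i j k : Fin t.words.length, s.fld 2 i j k = t.triple i j k
  gen : ∀ (i : Fin t.words.length) (j : Fin n), s.fld 3 i j 0 = t.gen i j

/-! Injectivity. A subspace is recovered from its orthogonal projection, and the projection onto `g
• V` is `g P g*` (`Gr.projMatrix_smul`), so the question is when two tuples `A`, `B` of self-adjoint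
matrices are conjugate by a unitary matrix. Which words are selected depends only on linear
relations among word values; conjugation preserves these and all the traces (`traceData_conj`).

Conversely, let `A` and `B` have the same data. The selected words have values that span the algebra
generated by the tuple, because the last pass appends nothing (`evalWord_mem_wordSpan_basisWords`).
Let `L` be the span of the pairs `(E_j(A), E_j(B))`. Since `tr(X*Y)` is positive definite, an
element of the algebra is determined by its traces against the words. Hence the triple traces show
that `L` is closed under products, and the traces with the generators show that `L` contains each
`(A_l, B_l)`. The algebra `S` generated by these pairs therefore lies in `L`. It is star-closed, and
pairing with the empty word shows that both coordinates of each member have the same trace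
(`exists_conj_of_traceData_eq`).

That such an `S` is implemented by a unitary matrix is the statement that characters determine
representations, here over either field and without a decomposition into irreducibles
(`exists_unitary_intertwines`). Take an intertwining partial isometry with minimal kernel. If it is
not unitary, averaging over dual bases of the trace form yields a nonzero intertwiner between the
complements (`exists_intertwines_compl`), and its polar part (`exists_partialIsometry`) enlarges the
partial isometry.

Complexity. A list of selected words has at most `d²` members, so `d²` bounded passes replace the
while loop (`iterate_basisPass_eq_basisWords`). Each pass tries at most `n d²` words, and
Gram–Schmidt decides each in `O(d⁴)` operations (`Prog.run_tryWord`), which gives `O(n d⁸)`. The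
`d⁶` triple traces cost `O(d²)` each once the products of pairs are known (`Prog.run_traceCube`). -/

open Matrix

/-! ### Star-closed algebras of pairs with equal traces, and the unitary matrix that implements
them. -/

section UnitaryEquivalence

variable {𝕜 : Type*} [RCLike 𝕜] {ι : Type*} [Fintype ι] [DecidableEq ι]

open scoped ComplexOrder MatrixOrder in
/-- A pseudo-inverse of the square root of `Tᴴ * T`. -/
theorem exists_pseudoInverse_sqrt (T : Matrix ι ι 𝕜) :
    ∃ g : Matrix ι ι 𝕜, gᴴ = g ∧ (∀ x, Commute (Tᴴ * T) x → Commute g x) ∧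
      g * g * (Tᴴ * T) * g = g ∧ g * g * ((Tᴴ * T) * (Tᴴ * T)) = Tᴴ * T := by
  set H := Tᴴ * T with hH
  have hsa : IsSelfAdjoint H := (Matrix.isHermitian_conjTranspose_mul_self T).isSelfAdjoint
  have hfin : (spectrum ℝ H).Finite := Matrix.finite_real_spectrum
  have hc : ∀ f : ℝ → ℝ, ContinuousOn f (spectrum ℝ H) := fun f => hfin.continuousOn f
  have hid : cfc (fun t : ℝ => t) H = H := cfc_id' ℝ H hsa
  have hpos : ∀ t ∈ spectrum ℝ H, 0 ≤ t := by
    intro t ht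
    exact spectrum_nonneg_of_nonneg
      (Matrix.nonneg_iff_posSemidef.2 (Matrix.posSemidef_conjTranspose_mul_self T)) ht
  -- Since `0⁻¹ = 0`, `f` vanishes at `0`. The functional calculus thus gives `|T|⁻¹` on the support
  -- of `T` and zero on its kernel, and the identities below hold at the eigenvalue `0` too.
  let f : ℝ → ℝ := fun t => (√t)⁻¹
  have hf : ∀ t ∈ spectrum ℝ H, t ≠ 0 → f t * f t * t = 1 := by
    intro t ht h0
    have h1 : √t * √t = t := Real.mul_self_sqrt (hpos t ht)
    have h2 : √t ≠ 0 := by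
      intro h
      rw [h, zero_mul] at h1
      exact h0 h1.symm
    simp only [f]
    rw [← mul_inv, h1, inv_mul_cancel₀ h0]
  refine ⟨cfc f H, ?_, fun x hx => hx.cfc_real f, ?_, ?_⟩
  · exact (cfc_predicate f H : IsSelfAdjoint _)
  · rw [← cfc_mul f f H (hc _) (hc _)]
    nth_rw 2 [← hid]
    rw [← cfc_mul _ _ H (hc _) (hc _), ← cfc_mul _ _ H (hc _) (hc _)]
    refine cfc_congr fun t ht => ?_
    by_cases h0 : t = 0
    · simp [f, h0]
    · simp [hf t ht h0]
  · rw [← cfc_mul f f H (hc _) (hc _)]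
    nth_rw 2 3 4 [← hid]
    rw [← cfc_mul _ _ H (hc _) (hc _), ← cfc_mul _ _ H (hc _) (hc _)]
    refine cfc_congr fun t ht => ?_
    by_cases h0 : t = 0
    · simp [f, h0]
    · simp only [← mul_assoc, hf t ht h0, one_mul]

/-- `T` intertwines the two coordinates of the members of `S`. -/
def Intertwines (S : Subalgebra 𝕜 (Matrix ι ι 𝕜 × Matrix ι ι 𝕜)) (T : Matrix ι ι 𝕜) : Prop :=
  ∀ x y, (x, y) ∈ S → y * T = T * x

variable {S : Subalgebra 𝕜 (Matrix ι ι 𝕜 × Matrix ι ι 𝕜)}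

theorem Intertwines.conjTranspose_mul {T : Matrix ι ι 𝕜} (hT : Intertwines S T)
    (hstar : ∀ x y, (x, y) ∈ S → (xᴴ, yᴴ) ∈ S) {x y : Matrix ι ι 𝕜} (h : (x, y) ∈ S) :
    Tᴴ * y = x * Tᴴ := by
  have := congrArg conjTranspose (hT _ _ (hstar _ _ h))
  simpa using this

theorem Intertwines.add {T T' : Matrix ι ι 𝕜} (hT : Intertwines S T) (hT' : Intertwines S T') :
    Intertwines S (T + T') := by
  intro x y h
  rw [mul_add, add_mul, hT x y h, hT' x y h]

/-- The bilinear form `(x, y), (x', y') ↦ tr (x * x')`. -/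
noncomputable def fstTraceForm (S : Subalgebra 𝕜 (Matrix ι ι 𝕜 × Matrix ι ι 𝕜)) :
    LinearMap.BilinForm 𝕜 S :=
  LinearMap.mk₂ 𝕜 (fun a b => (a.1.1 * b.1.1).trace)
    (by intros; simp [add_mul]) (by intros; simp) (by intros; simp [mul_add]) (by intros; simp)

theorem fstTraceForm_apply (a b : S) : fstTraceForm S a b = (a.1.1 * b.1.1).trace := rfl

-- The trace of `xᴴ * x` equals that of `yᴴ * y`, so both coordinates vanish together. This is why a
-- form that sees only first coordinates can be nondegenerate on `S`.
open scoped ComplexOrder in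
theorem fst_eq_zero_of_trace (a : S) (hstar : ∀ x y, (x, y) ∈ S → (xᴴ, yᴴ) ∈ S)
    (htr : ∀ x y, (x, y) ∈ S → x.trace = y.trace) (h : (a.1.1ᴴ * a.1.1).trace = 0) : a = 0 := by
  obtain ⟨⟨x, y⟩, ha⟩ := a
  have h2 := htr _ _ (S.mul_mem (hstar x y ha) ha)
  simp only at h h2
  rw [h] at h2
  have hx := Matrix.trace_conjTranspose_mul_self_eq_zero_iff.1 h
  have hy := Matrix.trace_conjTranspose_mul_self_eq_zero_iff.1 h2.symm
  subst hx hy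
  rfl

/-- Test an element against its own adjoint, which lies in `S`. -/
theorem fstTraceForm_nondegenerate (hstar : ∀ x y, (x, y) ∈ S → (xᴴ, yᴴ) ∈ S)
    (htr : ∀ x y, (x, y) ∈ S → x.trace = y.trace) : (fstTraceForm S).Nondegenerate := by
  have hs : (fstTraceForm S).IsSymm := ⟨fun a b => by
    simp [fstTraceForm_apply, Matrix.trace_mul_comm a.1.1]⟩
  have hl : ∀ a : S, (∀ b, fstTraceForm S a b = 0) → a = 0 := by
    intro a ha
    refine fst_eq_zero_of_trace a hstar htr ?_
    have := ha ⟨(a.1.1ᴴ, a.1.2ᴴ), hstar _ _ a.2⟩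
    rw [fstTraceForm_apply] at this
    rwa [Matrix.trace_mul_comm]
  refine ⟨hl, fun a ha => hl a fun b => ?_⟩
  have := ha b
  rwa [fstTraceForm_apply, Matrix.trace_mul_comm] at this

theorem mul_single_mul_apply (X Y : Matrix ι ι 𝕜) (a c k l : ι) :
    (X * Matrix.single c k 1 * Y : Matrix ι ι 𝕜) a l = X a c * Y k l := by
  rw [Matrix.mul_apply, Finset.sum_eq_single k]
  · rw [Matrix.mul_single_apply_same, mul_one]
  · intro j _ hj
    rw [Matrix.mul_single_apply_of_ne (hbj := hj), zero_mul]
  · simp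

/-- Every complement of an intertwining partial isometry supports an intertwiner. -/
theorem exists_intertwines_compl (hstar : ∀ x y, (x, y) ∈ S → (xᴴ, yᴴ) ∈ S)
    (htr : ∀ x y, (x, y) ∈ S → x.trace = y.trace) {p q : Matrix ι ι 𝕜}
    (hp : pᴴ = p)
    (hpc : ∀ x y, (x, y) ∈ S → x * p = p * x) (hqc : ∀ x y, (x, y) ∈ S → y * q = q * y)
    (hpq : ∀ x y, (x, y) ∈ S → (x * p).trace = (y * q).trace) (hp0 : p.trace ≠ 0) :
    ∃ T, Intertwines S (q * T * p) ∧ q * T * p ≠ 0 := by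
  classical
  set B := fstTraceForm S
  have hB := fstTraceForm_nondegenerate hstar htr
  have hs : B.IsSymm := ⟨fun a b => by
    simp [B, fstTraceForm_apply, Matrix.trace_mul_comm a.1.1]⟩
  let b := Module.finBasis 𝕜 S
  let b' := B.dualBasis hB b
  have hexp : ∀ a : S, a = ∑ i, B a (b' i) • b i := by
    intro a
    conv_lhs => rw [← b.sum_repr a]
    refine Finset.sum_congr rfl fun i _ => ?_
    congr 1
    conv_rhs => rw [← b.sum_repr a]
    rw [map_sum, LinearMap.sum_apply, Finset.sum_eq_single i]
    · rw [map_smul, LinearMap.smul_apply, LinearMap.BilinForm.apply_dualBasis_right hB hs]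
      simp
    · intro k _ hk
      rw [map_smul, LinearMap.smul_apply, LinearMap.BilinForm.apply_dualBasis_right hB hs]
      simp [hk]
    · simp
  have hexp' : ∀ a : S, a = ∑ i, B (b i) a • b' i := by
    intro a
    conv_lhs => rw [← b'.sum_repr a]
    refine Finset.sum_congr rfl fun i _ => ?_
    rw [LinearMap.BilinForm.dualBasis_repr_apply, hs.eq]
  let l₁ : S →ₗ[𝕜] Matrix ι ι 𝕜 := LinearMap.fst 𝕜 _ _ ∘ₗ S.toSubmodule.subtype
  let l₂ : S →ₗ[𝕜] Matrix ι ι 𝕜 := LinearMap.snd 𝕜 _ _ ∘ₗ S.toSubmodule.subtype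
  -- This plays the role of averaging over a group: the Casimir element `∑ b i ⊗ b' i` satisfies `∑
  -- a b i ⊗ b' i = ∑ b i ⊗ b' i a`, so `Φ T` intertwines for every `T`.
  let Φ : Matrix ι ι 𝕜 → Matrix ι ι 𝕜 := fun T => ∑ i, (b i).1.2 * T * (b' i).1.1
  have hΦ : ∀ T, Intertwines S (Φ T) := by
    intro T x y hxy
    let a : S := ⟨(x, y), hxy⟩
    have h1 : ∀ i, y * (b i).1.2 = ∑ k, B (a * b i) (b' k) • (b k).1.2 := by
      intro i
      have := congrArg l₂ (hexp (a * b i))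
      simp only [map_sum, map_smul] at this
      exact this
    have h2 : ∀ k, (b' k).1.1 * x = ∑ i, B (b i) (b' k * a) • (b' i).1.1 := by
      intro i
      have := congrArg l₁ (hexp' (b' i * a))
      simp only [map_sum, map_smul] at this
      exact this
    simp only [Φ, Finset.mul_sum, Finset.sum_mul]
    calc ∑ i, y * ((b i).1.2 * T * (b' i).1.1)
        = ∑ i, ∑ k, B (a * b i) (b' k) • ((b k).1.2 * T * (b' i).1.1) := by
          refine Finset.sum_congr rfl fun i _ => ?_
          rw [← mul_assoc, ← mul_assoc, h1, Finset.sum_mul, Finset.sum_mul]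
          simp
      _ = ∑ k, ∑ i, B (b i) (b' k * a) • ((b k).1.2 * T * (b' i).1.1) := by
          rw [Finset.sum_comm]
          refine Finset.sum_congr rfl fun k _ => Finset.sum_congr rfl fun i _ => ?_
          congr 1
          simp only [B, fstTraceForm_apply]
          change ((a.1.1 * (b i).1.1) * (b' k).1.1).trace = ((b i).1.1 * ((b' k).1.1 * a.1.1)).trace
          rw [mul_assoc, Matrix.trace_mul_comm, mul_assoc]
      _ = _ := by
          refine Finset.sum_congr rfl fun k _ => ?_
          rw [mul_assoc, h2, Finset.mul_sum]
          simp
  -- If the claim fails, then `q * Φ T * p = 0` for all `T`. Taking matrix units for `T` separates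
  -- the two factors of each summand and leads to `p.trace = 0`.
  by_contra! hcon
  have hz : ∀ T, q * Φ T * p = 0 := by
    intro T
    refine hcon _ ?_
    intro x y hxy
    calc y * (q * Φ T * p) = q * (y * Φ T) * p := by
          rw [← mul_assoc, ← mul_assoc, hqc _ _ hxy, mul_assoc q]
      _ = q * Φ T * p * x := by
          rw [hΦ T x y hxy, mul_assoc, mul_assoc, mul_assoc, hpc _ _ hxy]
          simp only [mul_assoc]
  -- `z` represents the functional `a ↦ tr (a.2 * q) = tr (a.1 * p)` with respect to the trace form.
  let z : S := ∑ i, ((q * (b i).1.2).trace) • b' i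
  have hzp : z.1.1 * p = 0 := by
    have h1 : z.1.1 = ∑ i, ((q * (b i).1.2).trace) • (b' i).1.1 := by
      change l₁ z = _
      simp only [z, map_sum, map_smul]
      rfl
    rw [h1, Finset.sum_mul]
    ext k l
    simp only [smul_mul_assoc, Matrix.sum_apply, Matrix.smul_apply, smul_eq_mul, Matrix.trace,
      Matrix.diag, Finset.sum_mul]
    -- The trace over `c` is taken outside. Each summand is then the entry `(c, l)` of `q * Φ T *
    -- p`, with `T` the matrix unit at `(c, k)`.
    rw [Finset.sum_comm]
    refine Finset.sum_eq_zero fun c _ => ?_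
    have h2 := congrFun (congrFun (hz (Matrix.single c k 1)) c) l
    simp only [Φ, Finset.mul_sum, Finset.sum_mul, Matrix.sum_apply] at h2
    rw [Matrix.zero_apply] at h2
    rw [← h2]
    refine Finset.sum_congr rfl fun i _ => ?_
    rw [← mul_single_mul_apply]
    simp only [mul_assoc]
  have hzB : ∀ a : S, (z.1.1 * a.1.1).trace = (a.1.1 * p).trace := by
    intro a
    rw [hpq _ _ a.2]
    have h1 : a.1.2 = ∑ i, B a (b' i) • (b i).1.2 := by
      have := congrArg l₂ (hexp a)
      simp only [map_sum, map_smul] at this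
      exact this
    rw [← fstTraceForm_apply, h1, Matrix.trace_mul_comm, Finset.mul_sum, Matrix.trace_sum]
    simp only [z, map_sum, LinearMap.sum_apply, map_smul, LinearMap.smul_apply, mul_smul_comm,
      Matrix.trace_smul, smul_eq_mul]
    refine Finset.sum_congr rfl fun i _ => ?_
    rw [mul_comm, hs.eq]
  -- Evaluate the functional at the adjoint of `z`: this gives `tr (zᴴ * p)`, which vanishes because
  -- `z * p = 0`.
  have hz0 : z = 0 := by
    refine fst_eq_zero_of_trace z hstar htr ?_
    rw [Matrix.trace_mul_comm]
    have h1 := hzB ⟨(z.1.1ᴴ, z.1.2ᴴ), hstar _ _ z.2⟩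
    simp only at h1
    rw [h1, hpc _ _ (hstar _ _ z.2), ← hp, ← Matrix.conjTranspose_mul, hzp]
    simp
  have h1 := hzB 1
  rw [hz0] at h1
  simp at h1
  exact hp0 h1.symm

/-- A nonzero intertwiner yields a nonzero partial isometry with the same properties. -/
theorem exists_partialIsometry (hstar : ∀ x y, (x, y) ∈ S → (xᴴ, yᴴ) ∈ S)
    {T p q : Matrix ι ι 𝕜} (hT : Intertwines S T) (hT0 : T ≠ 0) (hp : pᴴ = p)
    (hTp : T * p = 0) (hqT : q * T = 0) :
    ∃ W, Intertwines S W ∧ W ≠ 0 ∧ W * Wᴴ * W = W ∧ W * p = 0 ∧ q * W = 0 := by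
  obtain ⟨g, hg, hgc, h1, h2⟩ := exists_pseudoInverse_sqrt T
  have hpT : p * Tᴴ = 0 := by
    have := congrArg conjTranspose hTp
    simpa [hp] using this
  have hgH := (hgc _ (Commute.refl _)).eq
  -- The partial isometry in the polar decomposition of `T`. Whatever commutes with `Tᴴ * T`
  -- commutes with `g`; this applies to the first coordinates of `S` and to `p`.
  refine ⟨T * g, ?_, ?_, ?_, ?_, ?_⟩
  · intro x y h
    have hx : Commute (Tᴴ * T) x := by
      change Tᴴ * T * x = x * (Tᴴ * T)
      rw [mul_assoc, ← hT x y h, ← mul_assoc, hT.conjTranspose_mul hstar h, mul_assoc]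
    rw [← mul_assoc, hT x y h, mul_assoc, mul_assoc, (hgc x hx).eq]
  · intro h
    apply hT0
    have h3 : Tᴴ * T = 0 := by
      rw [← h2]
      calc g * g * (Tᴴ * T * (Tᴴ * T)) = g * (g * (Tᴴ * T)) * (Tᴴ * T) := by
            simp only [mul_assoc]
        _ = g * Tᴴ * (T * g) * (Tᴴ * T) := by rw [hgH]; simp only [mul_assoc]
        _ = 0 := by rw [h]; simp
    open scoped ComplexOrder in
    exact Matrix.conjTranspose_mul_self_eq_zero.1 h3
  · rw [conjTranspose_mul, hg]
    calc T * g * (g * Tᴴ) * (T * g) = T * (g * g * (Tᴴ * T) * g) := by simp only [mul_assoc]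
      _ = T * g := by rw [h1]
  · have hx : Commute (Tᴴ * T) p := by
      change Tᴴ * T * p = p * (Tᴴ * T)
      rw [mul_assoc, hTp, ← mul_assoc, hpT, mul_zero, zero_mul]
    rw [mul_assoc, (hgc p hx).eq, ← mul_assoc, hTp, zero_mul]
  · rw [← mul_assoc, hqT, zero_mul]

/-- A star-closed algebra of pairs of matrices whose coordinates have equal traces is
the graph of a conjugation by a unitary matrix. -/
theorem exists_unitary_intertwines (hstar : ∀ x y, (x, y) ∈ S → (xᴴ, yᴴ) ∈ S)
    (htr : ∀ x y, (x, y) ∈ S → x.trace = y.trace) :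
    ∃ U ∈ Matrix.unitaryGroup ι 𝕜, Intertwines S U := by
  -- Minimal kernels exist in finite dimension; the zero matrix shows that there are candidates.
  let P : Set (Submodule 𝕜 (ι → 𝕜)) :=
    {K | ∃ W, Intertwines S W ∧ W * Wᴴ * W = W ∧ LinearMap.ker W.mulVecLin = K}
  have hP : P.Nonempty := ⟨_, 0, fun x y _ => by simp, by simp, rfl⟩
  obtain ⟨K, ⟨W, hW, hWW, rfl⟩, hmin⟩ :=
    WellFounded.has_min (wellFounded_lt (α := Submodule 𝕜 (ι → 𝕜))) P hP
  set p := 1 - Wᴴ * W with hpdef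
  set q := 1 - W * Wᴴ with hqdef
  have hp : pᴴ = p := by simp [p]
  have hWp : W * p = 0 := by rw [hpdef, mul_sub, mul_one, ← mul_assoc, hWW, sub_self]
  have hqW : q * W = 0 := by rw [hqdef, sub_mul, one_mul, hWW, sub_self]
  have hpp : p * p = p := by
    conv_lhs => rw [hpdef, sub_mul, one_mul, mul_assoc, hWp, mul_zero, sub_zero]
  have hpc : ∀ x y, (x, y) ∈ S → x * p = p * x := by
    intro x y h
    rw [hpdef, mul_sub, sub_mul, mul_assoc, ← hW x y h, ← mul_assoc, ← mul_assoc,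
      hW.conjTranspose_mul hstar h]
    simp
  have hqc : ∀ x y, (x, y) ∈ S → y * q = q * y := by
    intro x y h
    rw [hqdef, mul_sub, sub_mul, mul_assoc, hW.conjTranspose_mul hstar h, ← mul_assoc,
      ← mul_assoc, hW x y h]
    simp
  -- `W` matches the two parts that it supports, so equality of traces passes to the complements.
  have hpq : ∀ x y, (x, y) ∈ S → (x * p).trace = (y * q).trace := by
    intro x y h
    rw [hpdef, hqdef, mul_sub, mul_sub, Matrix.trace_sub, Matrix.trace_sub, ← mul_assoc y,
      hW x y h, mul_assoc W x, Matrix.trace_mul_comm W, mul_assoc, mul_one, mul_one, htr x y h]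
  have hp0 : p = 0 := by
    by_contra hne
    have htp : p.trace ≠ 0 := by
      intro h
      apply hne
      open scoped ComplexOrder in
      refine Matrix.trace_conjTranspose_mul_self_eq_zero_iff.1 ?_
      rw [hp, hpp, h]
    obtain ⟨T, hT, hT0⟩ := exists_intertwines_compl hstar htr hp hpc hqc hpq htp
    have hTW : q * T * p * (1 - p) = 0 := by rw [mul_sub, mul_one, mul_assoc _ p, hpp, sub_self]
    have hqq : q * q = q := by
      conv_lhs => rw [hqdef, mul_sub, mul_one, ← mul_assoc, hqW, zero_mul, sub_zero]
    have hWT : (1 - q) * (q * T * p) = 0 := by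
      rw [sub_mul, one_mul, ← mul_assoc, ← mul_assoc, hqq, sub_self]
    obtain ⟨X, hX, hX0, hXX, hXp, hqX⟩ :=
      exists_partialIsometry hstar hT hT0 (p := 1 - p) (q := 1 - q) (by simp [hp]) hTW hWT
    have e1 : X * Wᴴ = 0 := by
      have : X * (1 - p) * Wᴴ = 0 := by rw [hXp, zero_mul]
      have h2 : (1 - p) * Wᴴ = Wᴴ := by
        have := congrArg conjTranspose hWp
        rw [conjTranspose_mul, hp, conjTranspose_zero] at this
        rw [sub_mul, this, one_mul, sub_zero]
      rwa [mul_assoc, h2] at this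
    have e2 : Wᴴ * X = 0 := by
      have : Wᴴ * ((1 - q) * X) = 0 := by rw [hqX, mul_zero]
      have hq : qᴴ = q := by simp [q]
      have h2 : Wᴴ * (1 - q) = Wᴴ := by
        have := congrArg conjTranspose hqW
        rw [conjTranspose_mul, hq, conjTranspose_zero] at this
        rw [mul_sub, this, mul_one, sub_zero]
      rwa [← mul_assoc, h2] at this
    have e3 : W * Xᴴ = 0 := by simpa using congrArg conjTranspose e1
    have e4 : Xᴴ * W = 0 := by simpa using congrArg conjTranspose e2
    -- `X` has initial and final spaces orthogonal to those of `W`, so the sum is again a partial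
    -- isometry, with a strictly smaller kernel.
    refine hmin _ ⟨W + X, hW.add hX, ?_, rfl⟩ ?_
    · simp only [conjTranspose_add, mul_add, add_mul, e1, e3, hWW, hXX]
      rw [mul_assoc W, e2, mul_assoc X, e4]
      simp
    · have f2 : Wᴴ * (W + X) = Wᴴ * W := by rw [mul_add, e2, add_zero]
      rw [SetLike.lt_iff_le_and_exists]
      constructor
      · intro v hv
        rw [LinearMap.mem_ker, mulVecLin_apply] at hv ⊢
        calc W *ᵥ v = (W * (Wᴴ * (W + X))) *ᵥ v := by rw [f2, ← mul_assoc, hWW]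
          _ = (W * Wᴴ) *ᵥ ((W + X) *ᵥ v) := by rw [mulVec_mulVec, mul_assoc]
          _ = 0 := by rw [hv, mulVec_zero]
      · by_contra! hcon
        apply hX0
        -- `Xᴴ * X * v` lies in the kernel of `W`, while `W + X` sends it to `X * v`. Equal kernels
        -- would therefore force `X = 0`.
        have key : ∀ v, X *ᵥ v = 0 := by
          intro v
          have h1 : (Xᴴ * X) *ᵥ v ∈ LinearMap.ker W.mulVecLin := by
            rw [LinearMap.mem_ker, mulVecLin_apply, mulVec_mulVec, ← mul_assoc, e3, zero_mul,
              zero_mulVec]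
          have h2 := hcon _ h1
          rw [LinearMap.mem_ker, mulVecLin_apply, mulVec_mulVec, add_mul, ← mul_assoc, e3,
            zero_mul, zero_add, ← mul_assoc, hXX] at h2
          exact h2
        exact Matrix.ext_of_mulVec_single fun i => by rw [key, zero_mulVec]
  refine ⟨W, ?_, hW⟩
  rw [Matrix.mem_unitaryGroup_iff']
  rw [hpdef, sub_eq_zero] at hp0
  exact hp0.symm

end UnitaryEquivalence

/-! ### The selected words: number, length, spanning property, termination. -/

section Words

variable {𝕜 : Type*} [RCLike 𝕜] {n d : ℕ} (A B : Fin n → Matrix (Fin d) (Fin d) 𝕜)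

theorem evalWord_nil : evalWord A [] = 1 := rfl

theorem evalWord_cons (i : Fin n) (w : List (Fin n)) :
    evalWord A (i :: w) = A i * evalWord A w := by
  simp [evalWord]

theorem evalWord_append (v w : List (Fin n)) :
    evalWord A (v ++ w) = evalWord A v * evalWord A w := by
  simp [evalWord]

variable {A} in
theorem evalWord_mem_wordSpan {ws : List (List (Fin n))} {w : List (Fin n)} (h : w ∈ ws) :
    evalWord A w ∈ wordSpan A ws :=
  Submodule.subset_span ⟨w, h, rfl⟩

variable {A} in
theorem wordSpan_le_iff {ws : List (List (Fin n))} {K : Submodule 𝕜 (Matrix (Fin d) (Fin d) 𝕜)} :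
    wordSpan A ws ≤ K ↔ ∀ w ∈ ws, evalWord A w ∈ K := by
  rw [wordSpan, Submodule.span_le]
  constructor
  · intro h w hw
    exact h ⟨w, hw, rfl⟩
  · rintro h _ ⟨w, hw, rfl⟩
    exact h w hw

theorem wordSpan_mono {ws vs : List (List (Fin n))} (h : ws ⊆ vs) :
    wordSpan A ws ≤ wordSpan A vs :=
  wordSpan_le_iff.2 fun _ hw => evalWord_mem_wordSpan (h hw)

theorem wordSpan_append_singleton (ws : List (List (Fin n))) (w : List (Fin n)) :
    wordSpan A (ws ++ [w]) = wordSpan A ws ⊔ 𝕜 ∙ evalWord A w := by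
  apply le_antisymm
  · rw [wordSpan_le_iff]
    intro v hv
    rcases List.mem_append.1 hv with h | h
    · exact Submodule.mem_sup_left (evalWord_mem_wordSpan h)
    · rw [List.mem_singleton.1 h]
      exact Submodule.mem_sup_right (Submodule.mem_span_singleton_self _)
  · refine sup_le (wordSpan_mono A (List.subset_append_left _ _)) ?_
    rw [Submodule.span_singleton_le_iff_mem]
    exact evalWord_mem_wordSpan (by simp)

theorem prefix_tryWord (ws : List (List (Fin n))) (w : List (Fin n)) : ws <+: tryWord A ws w := by
  unfold tryWord
  split_ifs
  · exact List.prefix_rfl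
  · exact List.prefix_append _ _

theorem evalWord_mem_wordSpan_tryWord (ws : List (List (Fin n))) (w : List (Fin n)) :
    evalWord A w ∈ wordSpan A (tryWord A ws w) := by
  unfold tryWord
  split_ifs with h
  · exact h
  · exact evalWord_mem_wordSpan (by simp)

theorem prefix_foldl_tryWord (cs ws : List (List (Fin n))) : ws <+: cs.foldl (tryWord A) ws := by
  induction cs generalizing ws with
  | nil => exact List.prefix_rfl
  | cons c cs ih => exact (prefix_tryWord A ws c).trans (ih _)

theorem evalWord_mem_wordSpan_foldl (cs ws : List (List (Fin n))) {c : List (Fin n)}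
    (hc : c ∈ cs) : evalWord A c ∈ wordSpan A (cs.foldl (tryWord A) ws) := by
  induction cs generalizing ws with
  | nil => simp at hc
  | cons b cs ih =>
    rcases List.mem_cons.1 hc with rfl | h
    · exact wordSpan_mono A (prefix_foldl_tryWord A cs _).subset
        (evalWord_mem_wordSpan_tryWord A ws c)
    · exact ih _ h

/-- What every list of words that the algorithm meets satisfies. -/
structure IsShortIndependent (ws : List (List (Fin n))) : Prop where
  length_le_finrank : ws.length ≤ Module.finrank 𝕜 (wordSpan A ws)
  length_word_lt : ∀ w ∈ ws, w.length < ws.length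

variable {A}

theorem IsShortIndependent.length_le {ws : List (List (Fin n))} (h : IsShortIndependent A ws) :
    ws.length ≤ d * d := by
  refine h.length_le_finrank.trans ?_
  have := Submodule.finrank_le (wordSpan A ws)
  simpa [Module.finrank_matrix] using this

theorem isShortIndependent_init (hd : 1 ≤ d) : IsShortIndependent A [[]] where
  length_le_finrank := by
    have : NeZero d := ⟨by omega⟩
    change 1 ≤ _
    rw [Nat.one_le_iff_ne_zero, Ne, Submodule.finrank_eq_zero]
    intro h
    have h1 : evalWord A [] ∈ wordSpan A [[]] := evalWord_mem_wordSpan (by simp)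
    rw [h, Submodule.mem_bot] at h1
    exact one_ne_zero h1
  length_word_lt := by simp

/-- An appended word makes the span strictly larger, so the dimension keeps pace with the length of
the list. Its own length exceeds that of an old word by one, and the list grows by one as well. -/
theorem IsShortIndependent.tryWord {ws : List (List (Fin n))} (h : IsShortIndependent A ws)
    (i : Fin n) {w : List (Fin n)} (hw : w ∈ ws) : IsShortIndependent A (tryWord A ws (i :: w)) := by
  unfold _root_.tryWord
  split_ifs with hm
  · exact h
  · refine ⟨?_, ?_⟩
    · have hlt : wordSpan A ws < wordSpan A (ws ++ [i :: w]) := by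
        refine lt_of_le_of_ne (wordSpan_mono A (List.subset_append_left _ _)) fun he => hm ?_
        rw [he]
        exact evalWord_mem_wordSpan (by simp)
      have := Submodule.finrank_lt_finrank_of_lt hlt
      have := h.length_le_finrank
      rw [List.length_append, List.length_singleton]
      omega
    · intro v hv
      rw [List.length_append, List.length_singleton]
      rcases List.mem_append.1 hv with hv | hv
      · have := h.length_word_lt v hv
        omega
      · have := h.length_word_lt w hw
        rw [List.mem_singleton.1 hv, List.length_cons]
        omega

theorem IsShortIndependent.foldl {ws vs : List (List (Fin n))} (h : IsShortIndependent A vs)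
    (hsub : ws ⊆ vs) (cs : List (List (Fin n))) (hcs : ∀ c ∈ cs, ∃ i, ∃ w ∈ ws, c = i :: w) :
    IsShortIndependent A (cs.foldl (_root_.tryWord A) vs) := by
  induction cs generalizing vs with
  | nil => exact h
  | cons c cs ih =>
    obtain ⟨i, w, hw, rfl⟩ := hcs c (by simp)
    exact ih (h.tryWord i (hsub hw)) (fun x hx => (prefix_tryWord A vs _).subset (hsub hx))
      fun c hc => hcs c (by simp [hc])

theorem IsShortIndependent.basisPass {ws : List (List (Fin n))} (h : IsShortIndependent A ws) :
    IsShortIndependent A (basisPass A ws) := by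
  refine h.foldl (List.Subset.refl _) _ fun c hc => ?_
  simp only [List.mem_flatMap, List.mem_map] at hc
  obtain ⟨i, -, w, hw, rfl⟩ := hc
  exact ⟨i, w, hw, rfl⟩

variable (A)

theorem prefix_basisPass (ws : List (List (Fin n))) : ws <+: basisPass A ws :=
  prefix_foldl_tryWord A _ ws

theorem basisPass_eq_or_lt (ws : List (List (Fin n))) :
    basisPass A ws = ws ∨ ws.length < (basisPass A ws).length := by
  by_cases h : ws.length < (basisPass A ws).length
  · exact Or.inr h
  · exact Or.inl ((prefix_basisPass A ws).eq_of_length_le (by omega)).symm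

/-- This replaces the while loop by a power of the pass whose result is a fixed point; programs can
run only bounded loops. -/
theorem exists_iterate_eq_basisLoop (ws : List (List (Fin n))) :
    ∃ k, (basisPass A)^[k] ws = basisLoop A ws ∧ basisPass A (basisLoop A ws) = basisLoop A ws := by
  induction ws using basisLoop.induct A with
  | case1 ws h ih =>
    obtain ⟨k, hk, hs⟩ := ih
    rw [basisLoop, if_pos h]
    exact ⟨k + 1, hk, hs⟩
  | case2 ws h =>
    rw [basisLoop, if_neg h]
    have := (basisPass_eq_or_lt A ws).resolve_right h
    exact ⟨0, this.symm, by rw [this, this]⟩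

theorem basisPass_basisWords : basisPass A (basisWords A) = basisWords A :=
  (exists_iterate_eq_basisLoop A _).choose_spec.2

theorem iterate_basisPass (hd : 1 ≤ d) (k : ℕ) : IsShortIndependent A ((basisPass A)^[k] [[]]) := by
  induction k with
  | zero => exact isShortIndependent_init hd
  | succ k ih =>
    rw [Function.iterate_succ_apply']
    exact ih.basisPass

/-- As many passes as the matrix algebra has dimensions suffice. -/
theorem iterate_basisPass_eq_basisWords (hd : 1 ≤ d) :
    (basisPass A)^[d * d] [[]] = basisWords A := by
  -- Each pass before stabilization appends a word, and the list starts with one. At `k = d * d` the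
  -- second alternative would exceed the dimension of the matrix algebra.
  have hstab : ∀ k, basisPass A ((basisPass A)^[k] [[]]) = (basisPass A)^[k] [[]] ∨
      k + 1 ≤ ((basisPass A)^[k] [[]]).length := by
    intro k
    induction k with
    | zero => right; simp
    | succ k ih =>
      rw [Function.iterate_succ_apply']
      rcases ih with h | h
      · left
        rw [h, h]
      · rcases basisPass_eq_or_lt A ((basisPass A)^[k] [[]]) with h1 | h1
        · left
          rw [h1, h1]
        · right
          omega
  obtain ⟨k, hk, hfix⟩ := exists_iterate_eq_basisLoop A [[]]
  have hfix' : basisPass A ((basisPass A)^[d * d] [[]]) = (basisPass A)^[d * d] [[]] := by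
    refine (hstab (d * d)).resolve_right fun h => ?_
    have := (iterate_basisPass A hd (d * d)).length_le
    omega
  have h1 : (basisPass A)^[d * d + k] [[]] = (basisPass A)^[d * d] [[]] := by
    rw [add_comm, Function.iterate_add_apply]
    exact Function.iterate_fixed hfix' k
  have h2 : (basisPass A)^[d * d + k] [[]] = basisLoop A [[]] := by
    rw [Function.iterate_add_apply, hk]
    exact Function.iterate_fixed hfix _
  rw [← h1, h2, basisWords]

theorem isShortIndependent_basisWords (hd : 1 ≤ d) : IsShortIndependent A (basisWords A) :=
  iterate_basisPass_eq_basisWords A hd ▸ iterate_basisPass A hd _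

theorem nil_mem_basisWords : [] ∈ basisWords A := by
  obtain ⟨k, hk, -⟩ := exists_iterate_eq_basisLoop A [[]]
  rw [basisWords, ← hk]
  clear hk
  induction k with
  | zero => simp
  | succ k ih =>
    rw [Function.iterate_succ_apply']
    exact (prefix_basisPass A _).subset ih

/-- The final pass tries every `x_i w_j` and appends nothing, so the span is closed under left
multiplication by each `A i`. Induction on the word then starts from the identity. -/
theorem evalWord_mem_wordSpan_basisWords (w : List (Fin n)) :
    evalWord A w ∈ wordSpan A (basisWords A) := by
  induction w with
  | nil => exact evalWord_mem_wordSpan (nil_mem_basisWords A)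
  | cons i w ih =>
    rw [evalWord_cons]
    have : wordSpan A (basisWords A) ≤
        (wordSpan A (basisWords A)).comap (LinearMap.mulLeft 𝕜 (A i)) := by
      rw [wordSpan_le_iff]
      intro v hv
      rw [Submodule.mem_comap, LinearMap.mulLeft_apply, ← evalWord_cons, ← basisPass_basisWords]
      refine evalWord_mem_wordSpan_foldl A _ _ ?_
      simp only [List.mem_flatMap, List.mem_map]
      exact ⟨i, by simp, v, hv, rfl⟩
    exact this ih

variable {A B}

/-- The algorithm consults the matrices only through membership of word values in spans. -/
theorem basisWords_congr
    (h : ∀ ws w, evalWord A w ∈ wordSpan A ws ↔ evalWord B w ∈ wordSpan B ws) (hd : 1 ≤ d) :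
    basisWords A = basisWords B := by
  have h1 : tryWord A = tryWord B := by
    funext ws w
    unfold tryWord
    split_ifs with h1 h2 h2
    · rfl
    · exact absurd ((h ws w).1 h1) h2
    · exact absurd ((h ws w).2 h2) h1
    · rfl
  have h2 : basisPass A = basisPass B := by
    funext ws
    rw [basisPass, h1, basisPass]
  rw [← iterate_basisPass_eq_basisWords A hd, h2, iterate_basisPass_eq_basisWords B hd]

theorem wordSpan_of_map (L : Matrix (Fin d) (Fin d) 𝕜 →ₗ[𝕜] Matrix (Fin d) (Fin d) 𝕜)
    (hL : ∀ w, evalWord B w = L (evalWord A w)) (ws : List (List (Fin n))) :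
    wordSpan B ws = (wordSpan A ws).map L := by
  rw [wordSpan, wordSpan, Submodule.map_span]
  congr 1
  ext M
  constructor
  · rintro ⟨w, hw, rfl⟩
    exact ⟨_, ⟨w, hw, rfl⟩, (hL w).symm⟩
  · rintro ⟨_, ⟨w, hw, rfl⟩, rfl⟩
    exact ⟨w, hw, (hL w).symm⟩

end Words

/-! ### Trace data and unitary conjugacy of self-adjoint tuples. -/

section Invariance

variable {𝕜 : Type*} [RCLike 𝕜] {n d : ℕ} {A B : Fin n → Matrix (Fin d) (Fin d) 𝕜}

theorem evalWord_conj {g h : Matrix (Fin d) (Fin d) 𝕜} (hg : h * g = 1) (hg' : g * h = 1)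
    (hAB : ∀ i, B i = g * A i * h) (w : List (Fin n)) :
    evalWord B w = g * evalWord A w * h := by
  induction w with
  | nil => simp [evalWord_nil, hg']
  | cons i w ih =>
    rw [evalWord_cons, evalWord_cons, ih, hAB]
    calc g * A i * h * (g * evalWord A w * h) = g * A i * (h * g) * evalWord A w * h := by
          simp only [mul_assoc]
      _ = _ := by rw [hg, mul_one]; simp only [mul_assoc]

theorem traceData_conj (hd : 1 ≤ d) {g : Matrix (Fin d) (Fin d) 𝕜}
    (hg : g ∈ Matrix.unitaryGroup (Fin d) 𝕜) (hAB : ∀ i, B i = g * A i * gᴴ) :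
    traceData B = traceData A := by
  have h1 : gᴴ * g = 1 := Matrix.mem_unitaryGroup_iff'.1 hg
  have h2 : g * gᴴ = 1 := Matrix.mem_unitaryGroup_iff.1 hg
  have hE := evalWord_conj h1 h2 hAB
  have hinj : ∀ M, gᴴ * (g * M * gᴴ) * g = M := by
    intro M
    calc gᴴ * (g * M * gᴴ) * g = (gᴴ * g) * M * (gᴴ * g) := by simp only [mul_assoc]
      _ = M := by rw [h1, one_mul, mul_one]
  have hw : basisWords B = basisWords A := by
    refine basisWords_congr (fun ws w => ?_) hd
    let L : Matrix (Fin d) (Fin d) 𝕜 →ₗ[𝕜] Matrix (Fin d) (Fin d) 𝕜 :=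
      LinearMap.mulLeft 𝕜 g ∘ₗ LinearMap.mulRight 𝕜 gᴴ
    have hL : ∀ M, L M = g * M * gᴴ := fun M => (mul_assoc _ _ _).symm
    have hLi : Function.Injective L := by
      intro M N h
      rw [hL, hL] at h
      rw [← hinj M, h, hinj]
    have hLw : ∀ w, evalWord B w = L (evalWord A w) := fun w => by rw [hE, hL]
    rw [wordSpan_of_map L hLw, hLw, Submodule.mem_map]
    constructor
    · rintro ⟨M, hM, he⟩
      rwa [← hLi he]
    · intro h
      exact ⟨_, h, rfl⟩
  have hmul : ∀ M N : Matrix (Fin d) (Fin d) 𝕜,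
      g * M * gᴴ * (g * N * gᴴ) = g * (M * N) * gᴴ := by
    intro M N
    calc g * M * gᴴ * (g * N * gᴴ) = g * M * (gᴴ * g) * N * gᴴ := by simp only [mul_assoc]
      _ = _ := by rw [h1, mul_one]; simp only [mul_assoc]
  have htr : ∀ M : Matrix (Fin d) (Fin d) 𝕜, (g * M * gᴴ).trace = M.trace := by
    intro M
    rw [mul_assoc, Matrix.trace_mul_comm, mul_assoc, h1, mul_one]
  have hstar : ∀ M : Matrix (Fin d) (Fin d) 𝕜, (g * M * gᴴ)ᴴ = g * Mᴴ * gᴴ := by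
    intro M
    simp [mul_assoc]
  unfold traceData
  simp only [hE, hAB, hstar, hmul, htr]
  rw [hw]

/-- The index types depend on the list of words, so entries of equal data are matched through the
words that index them, without casts. -/
theorem TraceData.exists_pair_eq {𝕜 : Type*} {n : ℕ} {s t : TraceData 𝕜 n} (h : s = t)
    (i j : Fin s.words.length) :
    ∃ i' j', t.words.get i' = s.words.get i ∧ t.words.get j' = s.words.get j ∧
      s.pair i j = t.pair i' j' := by
  subst h
  exact ⟨i, j, rfl, rfl, rfl⟩

theorem TraceData.exists_triple_eq {𝕜 : Type*} {n : ℕ} {s t : TraceData 𝕜 n} (h : s = t)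
    (i j k : Fin s.words.length) :
    ∃ i' j' k', t.words.get i' = s.words.get i ∧ t.words.get j' = s.words.get j ∧
      t.words.get k' = s.words.get k ∧ s.triple i j k = t.triple i' j' k' := by
  subst h
  exact ⟨i, j, k, rfl, rfl, rfl, rfl⟩

theorem TraceData.exists_gen_eq {𝕜 : Type*} {n : ℕ} {s t : TraceData 𝕜 n} (h : s = t)
    (i : Fin s.words.length) (l : Fin n) : ∃ i', t.words.get i' = s.words.get i ∧ s.gen i l = t.gen i' l := by
  subst h
  exact ⟨i, rfl, rfl⟩

/-- Tuples of self-adjoint matrices with the same trace data are unitarily equivalent. -/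
theorem exists_conj_of_traceData_eq (hA : ∀ i, (A i)ᴴ = A i) (hB : ∀ i, (B i)ᴴ = B i)
    (h : traceData A = traceData B) :
    ∃ U ∈ Matrix.unitaryGroup (Fin d) 𝕜, ∀ i, B i = U * A i * Uᴴ := by
  have hw : basisWords A = basisWords B := congrArg TraceData.words h
  have hpair : ∀ v ∈ basisWords A, ∀ w ∈ basisWords A,
      ((evalWord A v)ᴴ * evalWord A w).trace = ((evalWord B v)ᴴ * evalWord B w).trace := by
    intro v hv w hw
    obtain ⟨i, rfl⟩ := List.mem_iff_get.1 hv
    obtain ⟨j, rfl⟩ := List.mem_iff_get.1 hw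
    obtain ⟨i', j', hi, hj, he⟩ := TraceData.exists_pair_eq h i j
    replace hi : (basisWords B).get i' = (basisWords A).get i := hi
    replace hj : (basisWords B).get j' = (basisWords A).get j := hj
    exact he.trans (by rw [← hi, ← hj]; rfl)
  have htriple : ∀ u ∈ basisWords A, ∀ v ∈ basisWords A, ∀ w ∈ basisWords A,
      ((evalWord A u)ᴴ * evalWord A v * evalWord A w).trace =
        ((evalWord B u)ᴴ * evalWord B v * evalWord B w).trace := by
    intro u hu v hv w hw
    obtain ⟨i, rfl⟩ := List.mem_iff_get.1 hu
    obtain ⟨j, rfl⟩ := List.mem_iff_get.1 hv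
    obtain ⟨k, rfl⟩ := List.mem_iff_get.1 hw
    obtain ⟨i', j', k', hi, hj, hk, he⟩ := TraceData.exists_triple_eq h i j k
    replace hi : (basisWords B).get i' = (basisWords A).get i := hi
    replace hj : (basisWords B).get j' = (basisWords A).get j := hj
    replace hk : (basisWords B).get k' = (basisWords A).get k := hk
    exact he.trans (by rw [← hi, ← hj, ← hk]; rfl)
  have hgen : ∀ v ∈ basisWords A, ∀ i,
      ((evalWord A v)ᴴ * A i).trace = ((evalWord B v)ᴴ * B i).trace := by
    intro v hv l
    obtain ⟨i, rfl⟩ := List.mem_iff_get.1 hv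
    obtain ⟨i', hi, he⟩ := TraceData.exists_gen_eq h i l
    replace hi : (basisWords B).get i' = (basisWords A).get i := hi
    exact he.trans (by rw [← hi]; rfl)
  -- `L` is the candidate for the graph of the isomorphism that takes each word value at `A` to its
  -- value at `B`.
  let L : Submodule 𝕜 (Matrix (Fin d) (Fin d) 𝕜 × Matrix (Fin d) (Fin d) 𝕜) :=
    Submodule.span 𝕜 {z | ∃ w ∈ basisWords A, z = (evalWord A w, evalWord B w)}
  have hLfst : ∀ M ∈ wordSpan A (basisWords A), ∃ N, (M, N) ∈ L := by
    have : wordSpan A (basisWords A) ≤ L.map (LinearMap.fst 𝕜 _ _) := by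
      rw [wordSpan_le_iff]
      intro w hw
      exact ⟨_, Submodule.subset_span ⟨w, hw, rfl⟩, rfl⟩
    intro M hM
    obtain ⟨⟨M', N⟩, hz, rfl⟩ := this hM
    exact ⟨N, hz⟩
  have hLsnd : ∀ z ∈ L, z.2 ∈ wordSpan B (basisWords B) := by
    have : L ≤ (wordSpan B (basisWords B)).comap (LinearMap.snd 𝕜 _ _) := by
      rw [Submodule.span_le]
      rintro _ ⟨w, hw', rfl⟩
      exact evalWord_mem_wordSpan (hw ▸ hw')
    exact this
  have hLtr : ∀ v ∈ basisWords A, ∀ z ∈ L,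
      ((evalWord A v)ᴴ * z.1).trace = ((evalWord B v)ᴴ * z.2).trace := by
    intro v hv z hz
    induction hz using Submodule.span_induction with
    | mem z hz =>
      obtain ⟨w, hw, rfl⟩ := hz
      exact hpair v hv w hw
    | zero => simp
    | add x y _ _ hx hy => simp [mul_add, hx, hy]
    | smul c x _ hx => simp [hx]
  -- Compare `N` with a partner `N'` of `M` in `L`: the difference lies in the span of the word
  -- values at `B` and is orthogonal to it, hence zero.
  have hmem : ∀ M N, M ∈ wordSpan A (basisWords A) → N ∈ wordSpan B (basisWords B) →
      (∀ v ∈ basisWords A, ((evalWord A v)ᴴ * M).trace = ((evalWord B v)ᴴ * N).trace) →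
      (M, N) ∈ L := by
    intro M N hM hN hMN
    obtain ⟨N', hN'⟩ := hLfst M hM
    have h1 : ∀ v ∈ basisWords B, ((evalWord B v)ᴴ * (N - N')).trace = 0 := by
      intro v hv
      rw [← hw] at hv
      rw [mul_sub, Matrix.trace_sub, ← hMN v hv, hLtr v hv _ hN', sub_self]
    have h2 : N - N' ∈ wordSpan B (basisWords B) := Submodule.sub_mem _ hN (hLsnd _ hN')
    have h3 : ∀ X ∈ wordSpan B (basisWords B), (Xᴴ * (N - N')).trace = 0 := by
      intro X hX
      induction hX using Submodule.span_induction with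
      | mem z hz =>
        obtain ⟨w, hw, rfl⟩ := hz
        exact h1 w hw
      | zero => simp
      | add x y _ _ hx hy => rw [conjTranspose_add, add_mul, Matrix.trace_add, hx, hy, add_zero]
      | smul c x _ hx => rw [conjTranspose_smul, smul_mul_assoc, Matrix.trace_smul, hx, smul_zero]
    open scoped ComplexOrder in
    have h4 := Matrix.trace_conjTranspose_mul_self_eq_zero_iff.1 (h3 _ h2)
    rw [sub_eq_zero.1 h4]
    exact hN'
  have hone : (1 : Matrix (Fin d) (Fin d) 𝕜 × Matrix (Fin d) (Fin d) 𝕜) ∈ L :=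
    Submodule.subset_span ⟨[], nil_mem_basisWords A, rfl⟩
  have hLmul : ∀ x y, x ∈ L → y ∈ L → x * y ∈ L := by
    have hL2 : L * L ≤ L := by
      rw [Submodule.span_mul_span, Submodule.span_le]
      rintro _ ⟨_, ⟨v, hv, rfl⟩, _, ⟨w, hw', rfl⟩, rfl⟩
      refine hmem _ _ ?_ ?_ ?_
      · rw [← evalWord_append]
        exact evalWord_mem_wordSpan_basisWords A _
      · rw [← evalWord_append]
        exact evalWord_mem_wordSpan_basisWords B _
      · intro u hu
        rw [← mul_assoc, ← mul_assoc]
        exact htriple u hu v hv w hw'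
    intro x y hx hy
    exact hL2 (Submodule.mul_mem_mul hx hy)
  -- For the algebra generated by the pairs `(A i, B i)`, closure under adjoints follows from
  -- self-adjointness of the generators.
  let S : Subalgebra 𝕜 (Matrix (Fin d) (Fin d) 𝕜 × Matrix (Fin d) (Fin d) 𝕜) :=
    Algebra.adjoin 𝕜 (Set.range fun i => (A i, B i))
  have hSL : ∀ x y, (x, y) ∈ S → (x, y) ∈ L := by
    have : S ≤ L.toSubalgebra hone hLmul := by
      refine Algebra.adjoin_le ?_
      rintro _ ⟨i, rfl⟩
      -- The one-letter word `x_i` need not have been selected, so the traces with `A i` are needed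
      -- to place this pair in `L`.
      refine hmem _ _ ?_ ?_ fun v hv => hgen v hv i
      · simpa [evalWord] using evalWord_mem_wordSpan_basisWords A [i]
      · simpa [evalWord] using evalWord_mem_wordSpan_basisWords B [i]
    exact fun x y hxy => this hxy
  have htr : ∀ x y, (x, y) ∈ S → x.trace = y.trace := by
    intro x y hxy
    simpa [evalWord_nil] using hLtr [] (nil_mem_basisWords A) _ (hSL x y hxy)
  have hstar : ∀ x y, (x, y) ∈ S → (xᴴ, yᴴ) ∈ S := by
    intro x y hxy
    change star (x, y) ∈ S
    generalize (x, y) = z at hxy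
    induction hxy using Algebra.adjoin_induction with
    | mem z hz =>
      obtain ⟨i, rfl⟩ := hz
      have : star (A i, B i) = (A i, B i) := Prod.ext (hA i) (hB i)
      rw [this]
      exact Algebra.subset_adjoin ⟨i, rfl⟩
    | algebraMap r =>
      rw [← algebraMap_star_comm]
      exact S.algebraMap_mem _
    | add x y _ _ hx hy =>
      rw [star_add]
      exact S.add_mem hx hy
    | mul x y _ _ hx hy =>
      rw [star_mul]
      exact S.mul_mem hy hx
  obtain ⟨U, hU, hUS⟩ := exists_unitary_intertwines hstar htr
  refine ⟨U, hU, fun i => ?_⟩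
  rw [← hUS _ _ (Algebra.subset_adjoin ⟨i, rfl⟩), mul_assoc]
  have : U * Uᴴ = 1 := Matrix.mem_unitaryGroup_iff.1 hU
  rw [this, mul_one]

end Invariance

/-! ### From subspaces to projections: the invariant separates orbits. -/

section Projections

variable {𝕜 : Type*} [RCLike 𝕜] {n r d : ℕ}

theorem Gr.toEuclideanCLM_projMatrix (V : Gr 𝕜 r d) :
    Matrix.toEuclideanCLM (n := Fin d) (𝕜 := 𝕜) V.projMatrix = V.space.starProjection :=
  (Matrix.toEuclideanCLM (n := Fin d) (𝕜 := 𝕜)).apply_symm_apply _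

theorem Gr.projMatrix_injective : Function.Injective (Gr.projMatrix : Gr 𝕜 r d → _) := by
  intro V W h
  apply Gr.ext
  have h1 := V.toEuclideanCLM_projMatrix
  rw [h, W.toEuclideanCLM_projMatrix] at h1
  rw [← Submodule.range_starProjection V.space, ← h1, Submodule.range_starProjection]

theorem Gr.conjTranspose_projMatrix (V : Gr 𝕜 r d) : V.projMatrixᴴ = V.projMatrix := by
  have h : star V.space.starProjection = V.space.starProjection :=
    isSelfAdjoint_starProjection V.space
  change star V.projMatrix = V.projMatrix
  rw [Gr.projMatrix]
  refine ((Matrix.toEuclideanCLM (n := Fin d) (𝕜 := 𝕜)).symm.map_star' _).symm.trans ?_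
  exact congrArg _ h

/-- The projection of `x` onto a subspace is the only point of it whose difference from `x` is
orthogonal to the subspace; `g P g* x` has this property for the image of `V`. -/
theorem Gr.projMatrix_smul (g : Matrix.unitaryGroup (Fin d) 𝕜) (V : Gr 𝕜 r d) :
    (g • V).projMatrix = g.1 * V.projMatrix * g.1ᴴ := by
  apply EquivLike.injective (Matrix.toEuclideanCLM (n := Fin d) (𝕜 := 𝕜))
  rw [Gr.toEuclideanCLM_projMatrix, map_mul, map_mul, Gr.toEuclideanCLM_projMatrix]
  have h1 : g.1ᴴ * g.1 = 1 := Matrix.mem_unitaryGroup_iff'.1 g.2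
  have h2 : g.1 * g.1ᴴ = 1 := Matrix.mem_unitaryGroup_iff.1 g.2
  set G := Matrix.toEuclideanCLM (n := Fin d) (𝕜 := 𝕜) g.1
  set G' := Matrix.toEuclideanCLM (n := Fin d) (𝕜 := 𝕜) g.1ᴴ with hG'
  have hadj : G' = ContinuousLinearMap.adjoint G := by
    exact (Matrix.toEuclideanCLM (n := Fin d) (𝕜 := 𝕜)).map_star' g.1
  have hGG : ∀ x, G (G' x) = x := by
    intro x
    have := congrArg (fun M => Matrix.toEuclideanCLM (n := Fin d) (𝕜 := 𝕜) M x) h2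
    simpa using this
  have hGG' : ∀ x, G' (G x) = x := by
    intro x
    have := congrArg (fun M => Matrix.toEuclideanCLM (n := Fin d) (𝕜 := 𝕜) M x) h1
    simpa using this
  have hsp : (g • V).space = V.space.map (G : EuclideanSpace 𝕜 (Fin d) →ₗ[𝕜] _) := rfl
  ext1 x
  change _ = G (V.space.starProjection (G' x))
  refine Submodule.eq_starProjection_of_mem_of_inner_eq_zero ?_ ?_
  · rw [hsp]
    exact ⟨_, V.space.starProjection_apply_mem _, rfl⟩
  · rw [hsp]
    rintro _ ⟨y, hy, rfl⟩
    change inner 𝕜 (x - G (V.space.starProjection (G' x))) (G y) = 0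
    rw [← ContinuousLinearMap.adjoint_inner_left, ← hadj, map_sub, hGG']
    exact Submodule.starProjection_inner_eq_zero _ _ hy

theorem isInjectiveInvariant_projInvariant (hd : 1 ≤ d) :
    IsInjectiveInvariant (Matrix.unitaryGroup (Fin d) 𝕜)
      (projInvariant : (Fin n → Gr 𝕜 r d) → TraceData 𝕜 n) := by
  intro V W
  constructor
  · intro h
    obtain ⟨U, hU, hUV⟩ := exists_conj_of_traceData_eq
      (fun i => (V i).conjTranspose_projMatrix) (fun i => (W i).conjTranspose_projMatrix) h
    refine ⟨⟨U, hU⟩, funext fun i => Gr.projMatrix_injective ?_⟩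
    rw [hUV i]
    exact Gr.projMatrix_smul ⟨U, hU⟩ (V i)
  · rintro ⟨g, rfl⟩
    exact (traceData_conj hd g.2 fun i => Gr.projMatrix_smul g (V i)).symm

end Projections

/-! ### Reading and writing the memory; matrices stored in arrays. -/

section Stores

variable {𝕜 : Type*}

@[simp] theorem Store.setNat_fld (s : Store 𝕜) (k i j l v : ℕ) : (s.setNat k i j l v).fld = s.fld :=
  rfl

@[simp] theorem Store.setFld_nat (s : Store 𝕜) (k i j l : ℕ) (v : 𝕜) :
    (s.setFld k i j l v).nat = s.nat :=
  rfl

theorem Store.setNat_nat_of_ne (s : Store 𝕜) {k k' : ℕ} (h : k' ≠ k) (i j l v : ℕ) :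
    (s.setNat k i j l v).nat k' = s.nat k' := by
  funext i' j' l'
  simp [Store.setNat, h]

theorem Store.setFld_fld_of_ne (s : Store 𝕜) {k k' : ℕ} (h : k' ≠ k) (i j l : ℕ) (v : 𝕜) :
    (s.setFld k i j l v).fld k' = s.fld k' := by
  funext i' j' l'
  simp [Store.setFld, h]

theorem Store.setNat_nat_self (s : Store 𝕜) (k i j l v i' j' l' : ℕ) :
    (s.setNat k i j l v).nat k i' j' l' =
      if i' = i ∧ j' = j ∧ l' = l then v else s.nat k i' j' l' := by
  simp [Store.setNat]

theorem Store.setFld_fld_self (s : Store 𝕜) (k i j l : ℕ) (v : 𝕜) (i' j' l' : ℕ) :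
    (s.setFld k i j l v).fld k i' j' l' =
      if i' = i ∧ j' = j ∧ l' = l then v else s.fld k i' j' l' := by
  simp [Store.setFld]

/-- A variable for natural numbers. -/
abbrev NExp.var (k : ℕ) : NExp := .get k (.const 0) (.const 0) (.const 0)

/-- The size of the matrices. -/
abbrev NExp.dim : NExp := .get 0 (.const 1) (.const 0) (.const 0)

/-- A variable for scalars. -/
abbrev FExp.var (k : ℕ) : FExp := .get k (.const 0) (.const 0) (.const 0)

theorem NExp.eval_var (s : Store 𝕜) (k : ℕ) : (NExp.var k).eval s = s.nat k 0 0 0 := rfl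

theorem NExp.eval_dim (s : Store 𝕜) : NExp.dim.eval s = s.nat 0 1 0 0 := rfl

/-- Matrix number `i` in the array `k`. -/
def Store.mat (s : Store 𝕜) (d k i : ℕ) : Matrix (Fin d) (Fin d) 𝕜 :=
  Matrix.of fun a b => s.fld k i a b

theorem Store.mat_apply (s : Store 𝕜) (d k i : ℕ) (a b : Fin d) :
    s.mat d k i a b = s.fld k i a b := rfl

theorem Store.mat_congr {s s' : Store 𝕜} {d k k' i i' : ℕ} (h : s.fld k i = s'.fld k' i') :
    s.mat d k i = s'.mat d k' i' := by
  ext a b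
  rw [mat_apply, mat_apply, h]

end Stores

/-! ### Frame and loop rules, and matrix subroutines with their costs. -/

section Programs

variable {𝕜 : Type*} [RCLike 𝕜]

/-! ### Rules for reasoning about programs -/

/-- The arrays of natural numbers that a program may change. -/
def Prog.natWrites : Prog → List ℕ
  | skip => []
  | seq p q => p.natWrites ++ q.natWrites
  | setNat k _ _ _ _ => [k]
  | setFld _ _ _ _ _ => []
  | ifLt _ _ p q => p.natWrites ++ q.natWrites
  | ifZero _ p q => p.natWrites ++ q.natWrites
  | loop k _ p => k :: p.natWrites

/-- The arrays of scalars that a program may change. -/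
def Prog.fldWrites : Prog → List ℕ
  | skip => []
  | seq p q => p.fldWrites ++ q.fldWrites
  | setNat _ _ _ _ _ => []
  | setFld k _ _ _ _ => [k]
  | ifLt _ _ p q => p.fldWrites ++ q.fldWrites
  | ifZero _ p q => p.fldWrites ++ q.fldWrites
  | loop _ _ p => p.fldWrites

theorem Prog.run_seq (p q : Prog) (s : Store 𝕜) :
    (seq p q).run s = ((q.run (p.run s).1).1, (p.run s).2 + (q.run (p.run s).1).2) := by
  rw [Prog.run]

theorem Prog.run_setNat (k : ℕ) (i j l e : NExp) (s : Store 𝕜) :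
    (setNat k i j l e).run s = (s.setNat k (i.eval s) (j.eval s) (l.eval s) (e.eval s),
      1 + i.cost + j.cost + l.cost + e.cost) := by
  rw [Prog.run]

theorem Prog.run_setFld (k : ℕ) (i j l : NExp) (e : FExp) (s : Store 𝕜) :
    (setFld k i j l e).run s = (s.setFld k (i.eval s) (j.eval s) (l.eval s) (e.eval s),
      1 + i.cost + j.cost + l.cost + e.cost) := by
  rw [Prog.run]

theorem Prog.run_loop (k : ℕ) (e : NExp) (p : Prog) (s : Store 𝕜) :
    (loop k e p).run s =
      ((runRounds (fun t s' => p.run (s'.setNat k 0 0 0 t)) s (e.eval s)).1,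
        1 + e.cost + (runRounds (fun t s' => p.run (s'.setNat k 0 0 0 t)) s (e.eval s)).2) := by
  rw [Prog.run]

/-- The frame rule: a syntactic check on the program shows that a whole array survives. All
non-interference arguments below rest on this and its analogue for scalars. -/
theorem Prog.run_nat (P : Prog) (s : Store 𝕜) {k : ℕ} (h : k ∉ P.natWrites) :
    (P.run s).1.nat k = s.nat k := by
  induction P generalizing s with
  | skip => rfl
  | seq p q hp hq =>
    simp only [natWrites, List.mem_append, not_or] at h
    rw [run_seq]
    exact (hq _ h.2).trans (hp _ h.1)
  | setNat k' i j l e =>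
    simp only [natWrites, List.mem_singleton] at h
    rw [run_setNat]
    exact Store.setNat_nat_of_ne _ h _ _ _ _
  | setFld k' i j l e => rw [run_setFld]; rfl
  | ifLt a b p q hp hq =>
    simp only [natWrites, List.mem_append, not_or] at h
    rw [run]
    split_ifs
    · exact hp _ h.1
    · exact hq _ h.2
  | ifZero e p q hp hq =>
    simp only [natWrites, List.mem_append, not_or] at h
    rw [run]
    split_ifs
    · exact hp _ h.1
    · exact hq _ h.2
  | loop k' e p hp =>
    simp only [natWrites, List.mem_cons, not_or] at h
    rw [run_loop]
    generalize e.eval s = N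
    induction N with
    | zero => rfl
    | succ N ih =>
      rw [runRounds]
      exact (hp _ h.2).trans ((Store.setNat_nat_of_ne _ h.1 _ _ _ _).trans ih)

theorem Prog.run_fld (P : Prog) (s : Store 𝕜) {k : ℕ} (h : k ∉ P.fldWrites) :
    (P.run s).1.fld k = s.fld k := by
  induction P generalizing s with
  | skip => rfl
  | seq p q hp hq =>
    simp only [fldWrites, List.mem_append, not_or] at h
    rw [run_seq]
    exact (hq _ h.2).trans (hp _ h.1)
  | setNat k' i j l e => rw [run_setNat]; rfl
  | setFld k' i j l e =>
    simp only [fldWrites, List.mem_singleton] at h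
    rw [run_setFld]
    exact Store.setFld_fld_of_ne _ h _ _ _ _
  | ifLt a b p q hp hq =>
    simp only [fldWrites, List.mem_append, not_or] at h
    rw [run]
    split_ifs
    · exact hp _ h.1
    · exact hq _ h.2
  | ifZero e p q hp hq =>
    simp only [fldWrites, List.mem_append, not_or] at h
    rw [run]
    split_ifs
    · exact hp _ h.1
    · exact hq _ h.2
  | loop k' e p hp =>
    simp only [fldWrites] at h
    rw [run_loop]
    generalize e.eval s = N
    induction N with
    | zero => rfl
    | succ N ih =>
      rw [runRounds]
      exact (hp _ h).trans ih

/-- The memory `s'` differs from `s` only in arrays that `P` may change. -/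
structure Prog.Frame (P : Prog) (s s' : Store 𝕜) : Prop where
  nat : ∀ k ∉ P.natWrites, s'.nat k = s.nat k
  fld : ∀ k ∉ P.fldWrites, s'.fld k = s.fld k

/-- The invariant rule for loops. -/
theorem Prog.run_loop_of_invariant (k : ℕ) (e : NExp) (p : Prog) (s : Store 𝕜) {N : ℕ}
    (hN : e.eval s = N) (I : ℕ → Store 𝕜 → Prop) (c : ℕ)
    (h0 : I 0 s) (hI : ∀ t s' v, I t s' → I t (s'.setNat k 0 0 0 v))
    (hstep : ∀ t < N, ∀ s', (loop k e p).Frame s s' → s'.nat k 0 0 0 = t → I t s' →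
      I (t + 1) (p.run s').1 ∧ (p.run s').2 ≤ c) :
    I N ((loop k e p).run s).1 ∧ ((loop k e p).run s).2 ≤ 1 + e.cost + N * (c + 1) := by
  rw [run_loop, hN]
  -- The frame condition is carried along with the invariant, so that each round may use that
  -- everything outside the written arrays has its value from the start of the loop.
  have key : ∀ t ≤ N, I t (runRounds (fun t s' => p.run (s'.setNat k 0 0 0 t)) s t).1 ∧
      (loop k e p).Frame s (runRounds (fun t s' => p.run (s'.setNat k 0 0 0 t)) s t).1 ∧
      (runRounds (fun t s' => p.run (s'.setNat k 0 0 0 t)) s t).2 ≤ t * (c + 1) := by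
    intro t ht
    induction t with
    | zero => exact ⟨h0, ⟨fun _ _ => rfl, fun _ _ => rfl⟩, by simp [runRounds]⟩
    | succ t ih =>
      obtain ⟨h1, h2, h3⟩ := ih (by omega)
      rw [runRounds]
      set s1 := (runRounds (fun t s' => p.run (s'.setNat k 0 0 0 t)) s t).1
      have hfr : (loop k e p).Frame s (s1.setNat k 0 0 0 t) := by
        refine ⟨fun k' hk' => ?_, fun k' hk' => h2.fld k' hk'⟩
        rw [Store.setNat_nat_of_ne _ (by rintro rfl; exact hk' (by simp [natWrites]))]
        exact h2.nat k' hk'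
      have hst := hstep t (by omega) _ hfr (by simp [Store.setNat_nat_self]) (hI _ _ _ h1)
      refine ⟨hst.1, ⟨fun k' hk' => ?_, fun k' hk' => ?_⟩, ?_⟩
      · rw [← hfr.nat k' hk']
        exact run_nat _ _ fun h => hk' (by simp [natWrites, h])
      · rw [← hfr.fld k' hk']
        exact run_fld _ _ hk'
      · have := hst.2
        simp only
        rw [add_mul]
        omega
  have h := key N le_rfl
  refine ⟨h.1, ?_⟩
  have := h.2.2
  simp only
  omega

/-! ### Matrix arithmetic -/

/-- Run `p` for every position in a matrix. -/
def Prog.forEntries (p : Prog) : Prog := loop 9 .dim (loop 10 .dim p)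

theorem Prog.natWrites_forEntries (p : Prog) : p.forEntries.natWrites = 9 :: 10 :: p.natWrites :=
  rfl

theorem Prog.fldWrites_forEntries (p : Prog) : p.forEntries.fldWrites = p.fldWrites := rfl

/-- The invariant rule for a loop over the positions in a matrix. -/
theorem Prog.run_forEntries (p : Prog) (s : Store 𝕜) {d : ℕ} (hd : s.nat 0 1 0 0 = d)
    (h0 : 0 ∉ p.natWrites) (h9 : 9 ∉ p.natWrites)
    (I : ℕ → ℕ → Store 𝕜 → Prop) (c : ℕ) (hinit : I 0 0 s)
    (hI : ∀ a b s' k v, k = 9 ∨ k = 10 → I a b s' → I a b (s'.setNat k 0 0 0 v))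
    (hrow : ∀ a s', I a d s' → I (a + 1) 0 s')
    (hstep : ∀ a < d, ∀ b < d, ∀ s', p.forEntries.Frame s s' → s'.nat 9 0 0 0 = a →
      s'.nat 10 0 0 0 = b → I a b s' → I a (b + 1) (p.run s').1 ∧ (p.run s').2 ≤ c) :
    I d 0 (p.forEntries.run s).1 ∧ (p.forEntries.run s).2 ≤ 5 + 6 * d + d ^ 2 * (c + 1) := by
  have hd' : ∀ s', p.forEntries.Frame s s' → NExp.dim.eval s' = d := by
    intro s' hs'
    rw [NExp.eval_dim, hs'.nat 0 (by simp [natWrites_forEntries, h0]), hd]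
  have key := run_loop_of_invariant 9 .dim (loop 10 .dim p) s
    (hd' s ⟨fun _ _ => rfl, fun _ _ => rfl⟩)
    (fun a s' => I a 0 s') (5 + d * (c + 1)) hinit (fun a s' v h => hI _ _ _ _ _ (Or.inl rfl) h) ?_
  · refine ⟨key.1, key.2.trans (le_of_eq ?_)⟩
    simp only [NExp.cost]
    ring
  · intro a ha s1 hfr1 hs1 hI1
    have key := run_loop_of_invariant 10 .dim p s1 (hd' s1 hfr1)
      (fun b s' => I a b s') c hI1 (fun a s' v h => hI _ _ _ _ _ (Or.inr rfl) h) ?_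
    · exact ⟨hrow _ _ key.1, key.2.trans (le_of_eq (by simp only [NExp.cost]))⟩
    · intro b hb s2 hfr2 hs2 hI2
      refine hstep a ha b hb s2 ⟨fun k hk => ?_, fun k hk => ?_⟩ ?_ hs2 hI2
      · rw [hfr2.nat k fun h => hk (by
          simp only [natWrites_forEntries, natWrites, List.mem_cons] at h ⊢
          tauto)]
        exact hfr1.nat k hk
      · rw [hfr2.fld k hk]
        exact hfr1.fld k hk
      · rw [hfr2.nat 9 (by simp [natWrites, h9]), hs1]

/-- Filling a matrix position by position. -/
theorem Prog.run_forEntries_fill (p : Prog) (s : Store 𝕜) {d : ℕ} (hd : s.nat 0 1 0 0 = d)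
    (h0 : 0 ∉ p.natWrites) (h9 : 9 ∉ p.natWrites)
    (k i : ℕ) (F : ℕ → ℕ → 𝕜) (c : ℕ)
    (hstep : ∀ a < d, ∀ b < d, ∀ s', p.forEntries.Frame s s' → s'.nat 9 0 0 0 = a →
      s'.nat 10 0 0 0 = b → s'.fld k i a b = s.fld k i a b →
      (∀ i' j l, (p.run s').1.fld k i' j l =
        if i' = i ∧ j = a ∧ l = b then F a b else s'.fld k i' j l) ∧ (p.run s').2 ≤ c) :
    (∀ i' j l, (p.forEntries.run s).1.fld k i' j l =
      if i' = i ∧ j < d ∧ l < d then F j l else s.fld k i' j l) ∧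
      (p.forEntries.run s).2 ≤ 5 + 6 * d + d ^ 2 * (c + 1) := by
  -- The positions that precede `(a, b)` in row-major order are filled; the rest of the array is
  -- untouched.
  have key := run_forEntries p s hd h0 h9 (fun a b s' => ∀ i' j l, s'.fld k i' j l =
    if i' = i ∧ (j < a ∧ l < d ∨ j = a ∧ l < b) then F j l else s.fld k i' j l) c
    (by simp) (fun _ _ _ _ _ _ h => h) ?_ ?_
  · refine ⟨fun i' j l => ?_, key.2⟩
    rw [key.1]
    simp
  · intro a s' h i' j l
    rw [h]
    refine if_congr ?_ rfl rfl
    simp only [Nat.lt_succ_iff_lt_or_eq, not_lt_zero, and_false, or_false]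
    tauto
  · intro a ha b hb s' hfr h9' h10' h
    -- The entry about to be written still has its initial value, which permits updates in place.
    have hst := hstep a ha b hb s' hfr h9' h10' (by rw [h]; simp)
    refine ⟨fun i' j l => ?_, hst.2⟩
    rw [hst.1, h]
    by_cases hi : i' = i
    · by_cases hj : j = a
      · by_cases hl : l = b
        · simp [hi, hj, hl]
        · have : l < b + 1 ↔ l < b := by omega
          simp [hj, hl, this]
      · simp [hj]
    · simp [hi]

theorem Prog.run_fill (s : Store 𝕜) {d : ℕ} (hd : s.nat 0 1 0 0 = d) (k i : ℕ) (ie : NExp)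
    (e : FExp) (F : ℕ → ℕ → 𝕜)
    (hie : ∀ s' : Store 𝕜, (∀ k, k ≠ 9 → k ≠ 10 → s'.nat k = s.nat k) → ie.eval s' = i)
    (he : ∀ a < d, ∀ b < d, ∀ s' : Store 𝕜, (∀ k, k ≠ 9 → k ≠ 10 → s'.nat k = s.nat k) →
      (∀ k' ≠ k, s'.fld k' = s.fld k') → s'.nat 9 0 0 0 = a → s'.nat 10 0 0 0 = b →
      s'.fld k i a b = s.fld k i a b → e.eval s' = F a b) :
    (∀ i' j l, ((setFld k ie (.var 9) (.var 10) e).forEntries.run s).1.fld k i' j l =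
      if i' = i ∧ j < d ∧ l < d then F j l else s.fld k i' j l) ∧
      ((setFld k ie (.var 9) (.var 10) e).forEntries.run s).2 ≤
        5 + 6 * d + d ^ 2 * (10 + ie.cost + e.cost) := by
  have key := run_forEntries_fill (setFld k ie (.var 9) (.var 10) e) s hd (by simp [natWrites])
    (by simp [natWrites]) k i F (9 + ie.cost + e.cost) ?_
  · refine ⟨key.1, key.2.trans (le_of_eq (by ring))⟩
  · intro a ha b hb s' hfr h9 h10 hk
    have hn : ∀ k, k ≠ 9 → k ≠ 10 → s'.nat k = s.nat k := fun k hk9 hk10 =>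
      hfr.nat k (by simp [natWrites_forEntries, natWrites, hk9, hk10])
    have hf : ∀ k' ≠ k, s'.fld k' = s.fld k' := fun k' hk' =>
      hfr.fld k' (by simp [fldWrites_forEntries, fldWrites, hk'])
    rw [run_setFld]
    constructor
    · intro i' j l
      simp only [Store.setFld_fld_self, NExp.eval_var, h9, h10, hie s' hn,
        he a ha b hb s' hn hf h9 h10 hk]
    · simp only [NExp.cost]
      omega

/-- Copy matrix number `ib` of the array `kb` to place `ia` in the array `ka`. -/
def Prog.copyMat (ka : ℕ) (ia : NExp) (kb : ℕ) (ib : NExp) : Prog :=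
  (setFld ka ia (.var 9) (.var 10) (.get kb ib (.var 9) (.var 10))).forEntries

/-- The bound `4` on the cost of an index is the cost of reading a variable; it makes the total
independent of the indices used. -/
theorem Prog.run_copyMat (s : Store 𝕜) {d : ℕ} (hd : s.nat 0 1 0 0 = d) (hd1 : 1 ≤ d)
    {ka kb i j : ℕ} {ia ib : NExp} (hk : kb ≠ ka)
    (hia : ∀ s' : Store 𝕜, (∀ k, k ≠ 9 → k ≠ 10 → s'.nat k = s.nat k) → ia.eval s' = i)
    (hib : ∀ s' : Store 𝕜, (∀ k, k ≠ 9 → k ≠ 10 → s'.nat k = s.nat k) → ib.eval s' = j)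
    (hca : ia.cost ≤ 4) (hcb : ib.cost ≤ 4) :
    ((copyMat ka ia kb ib).run s).1.mat d ka i = s.mat d kb j ∧
      (∀ i' ≠ i, ((copyMat ka ia kb ib).run s).1.fld ka i' = s.fld ka i') ∧
      ((copyMat ka ia kb ib).run s).2 ≤ 40 * d ^ 2 := by
  have key := run_fill s hd ka i ia (.get kb ib (.var 9) (.var 10)) (fun a b => s.fld kb j a b)
    hia ?_
  · refine ⟨?_, fun i' hi' => ?_, key.2.trans ?_⟩
    · ext a b
      rw [Store.mat_apply, Store.mat_apply]
      exact (key.1 _ _ _).trans (by simp)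
    · funext a b
      exact (key.1 _ _ _).trans (by simp [hi'])
    · simp only [FExp.cost, NExp.cost]
      nlinarith
  · intro a _ b _ s' hn hf h9 h10 _
    simp only [FExp.eval, NExp.eval_var, h9, h10, hib s' hn, hf kb hk]

theorem Prog.natWrites_copyMat (ka kb : ℕ) (ia ib : NExp) :
    (copyMat ka ia kb ib).natWrites = [9, 10] := rfl

theorem Prog.fldWrites_copyMat (ka kb : ℕ) (ia ib : NExp) :
    (copyMat ka ia kb ib).fldWrites = [ka] := rfl

/-- Multiply two matrices; the product goes to place `0` in the array `6`. -/
def Prog.mulMat (ka : ℕ) (ia : NExp) (kb : ℕ) (ib : NExp) : Prog :=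
  (seq (setFld 6 (.const 0) (.var 9) (.var 10) .zero)
    (loop 11 .dim (setFld 6 (.const 0) (.var 9) (.var 10)
      (.add (.get 6 (.const 0) (.var 9) (.var 10))
        (.mul (.get ka ia (.var 9) (.var 11)) (.get kb ib (.var 11) (.var 10))))))).forEntries

theorem Prog.natWrites_mulMat (ka kb : ℕ) (ia ib : NExp) :
    (mulMat ka ia kb ib).natWrites = [9, 10, 11] := rfl

theorem Prog.fldWrites_mulMat (ka kb : ℕ) (ia ib : NExp) :
    (mulMat ka ia kb ib).fldWrites = [6, 6] := rfl

theorem Prog.run_mulMat (s : Store 𝕜) {d : ℕ} (hd : s.nat 0 1 0 0 = d) (hd1 : 1 ≤ d)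
    {ka kb i j : ℕ} {ia ib : NExp} (hka : ka ≠ 6) (hkb : kb ≠ 6)
    (hia : ∀ s' : Store 𝕜, (∀ k, k ≠ 9 → k ≠ 10 → k ≠ 11 → s'.nat k = s.nat k) →
      ia.eval s' = i)
    (hib : ∀ s' : Store 𝕜, (∀ k, k ≠ 9 → k ≠ 10 → k ≠ 11 → s'.nat k = s.nat k) →
      ib.eval s' = j)
    (hca : ia.cost ≤ 4) (hcb : ib.cost ≤ 4) :
    ((mulMat ka ia kb ib).run s).1.mat d 6 0 = s.mat d ka i * s.mat d kb j ∧
      ((mulMat ka ia kb ib).run s).2 ≤ 100 * d ^ 3 := by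
  have key := run_forEntries_fill
    (seq (setFld 6 (.const 0) (.var 9) (.var 10) .zero)
      (loop 11 .dim (setFld 6 (.const 0) (.var 9) (.var 10)
        (.add (.get 6 (.const 0) (.var 9) (.var 10))
          (.mul (.get ka ia (.var 9) (.var 11)) (.get kb ib (.var 11) (.var 10)))))))
    s hd (by simp [natWrites]) (by simp [natWrites]) 6 0
    (fun a b => ∑ x ∈ Finset.range d, s.fld ka i a x * s.fld kb j x b) (16 + d * 60) ?_
  · refine ⟨?_, key.2.trans ?_⟩
    · ext a b
      rw [Store.mat_apply, Matrix.mul_apply]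
      refine (key.1 _ _ _).trans ?_
      rw [if_pos ⟨rfl, a.2, b.2⟩, Finset.sum_range]
      rfl
    · have h1 : d ≤ d ^ 3 := Nat.le_self_pow (by omega) d
      have h2 : d ^ 2 ≤ d ^ 3 := Nat.pow_le_pow_right hd1 (by omega)
      have h3 : 1 ≤ d ^ 3 := Nat.one_le_pow _ _ hd1
      linarith
  · intro a ha b hb s1 hfr1 h9 h10 _
    rw [run_seq, run_setFld]
    have hd2 : NExp.dim.eval (s1.setFld 6 0 a b 0) = d := by
      rw [NExp.eval_dim, Store.setFld_nat, hfr1.nat 0 (by simp [natWrites_forEntries, natWrites]),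
        hd]
    have key := run_loop_of_invariant 11 .dim (setFld 6 (.const 0) (.var 9) (.var 10)
      (.add (.get 6 (.const 0) (.var 9) (.var 10))
        (.mul (.get ka ia (.var 9) (.var 11)) (.get kb ib (.var 11) (.var 10)))))
      (s1.setFld 6 0 a b 0) hd2
      (fun t s' => ∀ i' j' l, s'.fld 6 i' j' l = if i' = 0 ∧ j' = a ∧ l = b then
        ∑ x ∈ Finset.range t, s.fld ka i a x * s.fld kb j x b else s1.fld 6 i' j' l) 59 ?_ ?_ ?_
    · simp only [NExp.eval, h9, h10, FExp.eval]
      refine ⟨key.1, ?_⟩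
      have := key.2
      simp only [NExp.cost, FExp.cost] at this ⊢
      omega
    · intro i' j' l
      rw [Store.setFld_fld_self]
      simp
    · exact fun _ _ _ h => h
    · intro t ht s2 hfr2 h11 hI
      have hn1 : ∀ k, k ≠ 9 → k ≠ 10 → k ≠ 11 → s2.nat k = s.nat k := by
        intro k hk9 hk10 hk11
        rw [hfr2.nat k (by simp [natWrites, hk11]), Store.setFld_nat,
          hfr1.nat k (by simp [natWrites_forEntries, natWrites, hk9, hk10, hk11])]
      have hf1 : ∀ k, k ≠ 6 → s2.fld k = s.fld k := by
        intro k hk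
        rw [hfr2.fld k (by simp [fldWrites, hk]), Store.setFld_fld_of_ne _ hk,
          hfr1.fld k (by simp [fldWrites_forEntries, fldWrites, hk])]
      have h9' : s2.nat 9 0 0 0 = a := by
        rw [hfr2.nat 9 (by simp [natWrites]), Store.setFld_nat, h9]
      have h10' : s2.nat 10 0 0 0 = b := by
        rw [hfr2.nat 10 (by simp [natWrites]), Store.setFld_nat, h10]
      rw [run_setFld]
      constructor
      · intro i' j' l
        simp only [Store.setFld_fld_self, NExp.eval, FExp.eval, h9', h10', h11,
          hia s2 hn1, hib s2 hn1, hf1 ka hka, hf1 kb hkb, hI]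
        by_cases h : i' = 0 ∧ j' = a ∧ l = b
        · simp [h, Finset.sum_range_succ]
        · simp [h]
      · simp only [NExp.cost, FExp.cost]
        omega

/-- Put `tr (Xᴴ * Y)` into the scalar variable `acc`, for `X` at place `ia` in the array `ka` and
`Y` at place `ib` in the array `kb`. -/
def Prog.traceMul (acc ka : ℕ) (ia : NExp) (kb : ℕ) (ib : NExp) : Prog :=
  seq (setFld acc (.const 0) (.const 0) (.const 0) .zero)
    (setFld acc (.const 0) (.const 0) (.const 0) (.add (.var acc)
      (.mul (.conj (.get ka ia (.var 9) (.var 10))) (.get kb ib (.var 9) (.var 10))))).forEntries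

theorem Prog.natWrites_traceMul (acc ka kb : ℕ) (ia ib : NExp) :
    (traceMul acc ka ia kb ib).natWrites = [9, 10] := rfl

theorem Prog.fldWrites_traceMul (acc ka kb : ℕ) (ia ib : NExp) :
    (traceMul acc ka ia kb ib).fldWrites = [acc, acc] := rfl

/-- `tr (Xᴴ * Y)` is the entrywise inner product, so `d²` rather than `d³` operations suffice. The
bound `d⁸` for all triple traces depends on this saving. -/
theorem Prog.run_traceMul (s : Store 𝕜) {d : ℕ} (hd : s.nat 0 1 0 0 = d) (hd1 : 1 ≤ d)
    {acc ka kb i j : ℕ} {ia ib : NExp} (hka : ka ≠ acc) (hkb : kb ≠ acc)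
    (hia : ∀ s' : Store 𝕜, (∀ k, k ≠ 9 → k ≠ 10 → s'.nat k = s.nat k) → ia.eval s' = i)
    (hib : ∀ s' : Store 𝕜, (∀ k, k ≠ 9 → k ≠ 10 → s'.nat k = s.nat k) → ib.eval s' = j)
    (hca : ia.cost ≤ 4) (hcb : ib.cost ≤ 4) :
    ((traceMul acc ka ia kb ib).run s).1.fld acc 0 0 0 =
        ((s.mat d ka i)ᴴ * s.mat d kb j).trace ∧
      ((traceMul acc ka ia kb ib).run s).2 ≤ 100 * d ^ 2 := by
  rw [traceMul, run_seq, run_setFld]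
  simp only [NExp.eval, FExp.eval]
  have key := run_forEntries (setFld acc (.const 0) (.const 0) (.const 0) (.add (.var acc)
      (.mul (.conj (.get ka ia (.var 9) (.var 10))) (.get kb ib (.var 9) (.var 10)))))
    (s.setFld acc 0 0 0 0) (d := d) hd (by simp [natWrites]) (by simp [natWrites])
    (fun a b s' => s'.fld acc 0 0 0 =
      ∑ x ∈ Finset.range a, ∑ y ∈ Finset.range d, star (s.fld ka i x y) * s.fld kb j x y +
      ∑ y ∈ Finset.range b, star (s.fld ka i a y) * s.fld kb j a y) 45 ?_ ?_ ?_ ?_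
  · constructor
    · rw [key.1, Matrix.trace]
      simp only [Finset.range_zero, Finset.sum_empty, add_zero, Matrix.diag, Matrix.mul_apply,
        Matrix.conjTranspose_apply, Store.mat_apply]
      rw [Finset.sum_comm, Finset.sum_range]
      simp only [Finset.sum_range]
    · have := key.2
      simp only [NExp.cost, FExp.cost] at this ⊢
      nlinarith
  · simp [Store.setFld_fld_self]
  · exact fun _ _ _ _ _ _ h => h
  · intro a s' h
    rw [h, Finset.sum_range_succ]
    simp
  · intro a ha b hb s' hfr h9 h10 hI
    have hn : ∀ k, k ≠ 9 → k ≠ 10 → s'.nat k = s.nat k := fun k hk9 hk10 =>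
      hfr.nat k (by simp [natWrites_forEntries, natWrites, hk9, hk10])
    have hf : ∀ k, k ≠ acc → s'.fld k = s.fld k := by
      intro k hk
      rw [hfr.fld k (by simp [fldWrites_forEntries, fldWrites, hk]), Store.setFld_fld_of_ne _ hk]
    rw [run_setFld]
    constructor
    · simp only [Store.setFld_fld_self, NExp.eval, FExp.eval, h9, h10, hia s' hn,
        hib s' hn, hf ka hka, hf kb hkb, hI]
      simp [Finset.sum_range_succ, add_assoc]
    · simp only [NExp.cost, FExp.cost]
      omega

end Programs

/-! ### Orthogonalization against the stored basis, and recording a new word. -/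

section BasisProgram

variable {𝕜 : Type*} [RCLike 𝕜]

/-! ### The Gram–Schmidt step -/

/-- Subtract from the matrix in the array `7` the multiple of a matrix in the array `5` that is
given by the quotient of two scalar variables. -/
def Prog.reduceMat : Prog :=
  (setFld 7 (.const 0) (.var 9) (.var 10) (.sub (.get 7 (.const 0) (.var 9) (.var 10))
    (.mul (.div (.var 8) (.var 9)) (.get 5 (.var 8) (.var 9) (.var 10))))).forEntries

theorem Prog.run_reduceMat (s : Store 𝕜) {d : ℕ} (hd : s.nat 0 1 0 0 = d) (hd1 : 1 ≤ d) :
    (reduceMat.run s).1.mat d 7 0 = s.mat d 7 0 -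
      (s.fld 8 0 0 0 / s.fld 9 0 0 0) • s.mat d 5 (s.nat 8 0 0 0) ∧
      (reduceMat.run s).2 ≤ 60 * d ^ 2 := by
  have key := run_fill s hd 7 0 (.const 0) (.sub (.get 7 (.const 0) (.var 9) (.var 10))
    (.mul (.div (.var 8) (.var 9)) (.get 5 (.var 8) (.var 9) (.var 10))))
    (fun a b => s.fld 7 0 a b - s.fld 8 0 0 0 / s.fld 9 0 0 0 * s.fld 5 (s.nat 8 0 0 0) a b)
    (fun _ _ => rfl) ?_
  · constructor
    · ext a b
      rw [Store.mat_apply]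
      exact (key.1 _ _ _).trans (by simp [Store.mat_apply])
    · refine key.2.trans ?_
      simp only [FExp.cost, NExp.cost]
      nlinarith
  · intro a _ b _ s' hn hf h9 h10 hk
    simp only [FExp.eval, NExp.eval, h9, h10, hk, hn 8 (by simp) (by simp), hf 8 (by simp),
      hf 9 (by simp), hf 5 (by simp)]

/-- Make the matrix in the array `7` orthogonal to the matrices in the array `5`. -/
def Prog.orthogonalize : Prog :=
  loop 8 (.var 1) (seq (traceMul 8 5 (.var 8) 7 (.const 0))
    (seq (traceMul 9 5 (.var 8) 5 (.var 8)) reduceMat))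

theorem Prog.natWrites_orthogonalize : orthogonalize.natWrites = [8, 9, 10, 9, 10, 9, 10] := rfl

theorem Prog.fldWrites_orthogonalize : orthogonalize.fldWrites = [8, 8, 9, 9, 7] := rfl

-- Gram–Schmidt without normalization, since square roots are not available: each coefficient is
-- divided by `tr (Xᴴ * X)`. Mutual orthogonality of the stored matrices ensures that later
-- subtractions do not spoil earlier orthogonality relations.
open scoped ComplexOrder in
theorem Prog.run_orthogonalize (s : Store 𝕜) {d m : ℕ} (hd : s.nat 0 1 0 0 = d) (hd1 : 1 ≤ d)
    (hm : s.nat 1 0 0 0 = m) (hmd : m ≤ d * d)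
    (horth : ∀ j < m, ∀ k < m, j ≠ k → ((s.mat d 5 j)ᴴ * s.mat d 5 k).trace = 0) :
    ((∀ k < m, ((s.mat d 5 k)ᴴ * (orthogonalize.run s).1.mat d 7 0).trace = 0) ∧
      s.mat d 7 0 - (orthogonalize.run s).1.mat d 7 0 ∈
        Submodule.span 𝕜 {M | ∃ k < m, M = s.mat d 5 k}) ∧
      (orthogonalize.run s).2 ≤ 300 * d ^ 4 := by
  have key := run_loop_of_invariant 8 (.var 1) (seq (traceMul 8 5 (.var 8) 7 (.const 0))
    (seq (traceMul 9 5 (.var 8) 5 (.var 8)) reduceMat)) s hm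
    (fun t s' => (∀ k < t, ((s.mat d 5 k)ᴴ * s'.mat d 7 0).trace = 0) ∧
      s.mat d 7 0 - s'.mat d 7 0 ∈ Submodule.span 𝕜 {M | ∃ k < m, M = s.mat d 5 k})
    (260 * d ^ 2) (by simp) (fun _ _ _ h => h) ?_
  · refine ⟨key.1, key.2.trans ?_⟩
    simp only [NExp.cost]
    have h1 : m * (260 * d ^ 2 + 1) ≤ (d * d) * (261 * d ^ 2) :=
      Nat.mul_le_mul hmd (by nlinarith)
    have h2 : 1 ≤ d ^ 4 := Nat.one_le_pow _ _ hd1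
    nlinarith
  · intro t ht s1 hfr h8 hI
    have hd' : s1.nat 0 1 0 0 = d := by
      rw [hfr.nat 0 (by change _ ∉ orthogonalize.natWrites; simp [natWrites_orthogonalize]), hd]
    have h5 : s1.fld 5 = s.fld 5 :=
      hfr.fld 5 (by change _ ∉ orthogonalize.fldWrites; simp [fldWrites_orthogonalize])
    have hvar : ∀ s2 : Store 𝕜, s2.nat 8 = s1.nat 8 → ∀ s' : Store 𝕜,
        (∀ k, k ≠ 9 → k ≠ 10 → s'.nat k = s2.nat k) → (NExp.var 8).eval s' = t := by
      intro s2 h s' h'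
      rw [NExp.eval_var, h' 8 (by simp) (by simp), h, h8]
    rw [run_seq, run_seq]
    obtain ⟨e1, c1⟩ := run_traceMul s1 hd' hd1 (acc := 8) (ka := 5) (kb := 7) (ia := .var 8)
      (ib := .const 0) (i := t) (j := 0) (by simp) (by simp) (hvar s1 rfl) (fun _ _ => rfl)
      (by simp [NExp.cost]) (by simp [NExp.cost])
    have f1 := run_fld (traceMul 8 5 (.var 8) 7 (.const 0)) s1 (k := 5)
      (by simp [fldWrites_traceMul])
    have g1 := run_fld (traceMul 8 5 (.var 8) 7 (.const 0)) s1 (k := 7)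
      (by simp [fldWrites_traceMul])
    have n1 := run_nat (traceMul 8 5 (.var 8) 7 (.const 0)) s1 (k := 8)
      (by simp [natWrites_traceMul])
    have m1 := run_nat (traceMul 8 5 (.var 8) 7 (.const 0)) s1 (k := 0)
      (by simp [natWrites_traceMul])
    generalize (traceMul 8 5 (.var 8) 7 (.const 0)).run s1 = r1 at *
    have hd2 : r1.1.nat 0 1 0 0 = d := by rw [m1, hd']
    obtain ⟨e2, c2⟩ := run_traceMul r1.1 hd2 hd1 (acc := 9) (ka := 5)
      (kb := 5) (ia := .var 8) (ib := .var 8) (i := t) (j := t) (by simp) (by simp)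
      (hvar r1.1 n1) (hvar r1.1 n1) (by simp [NExp.cost]) (by simp [NExp.cost])
    have f2 := run_fld (traceMul 9 5 (.var 8) 5 (.var 8)) r1.1 (k := 5)
      (by simp [fldWrites_traceMul])
    have g2 := run_fld (traceMul 9 5 (.var 8) 5 (.var 8)) r1.1 (k := 7)
      (by simp [fldWrites_traceMul])
    have k2 := run_fld (traceMul 9 5 (.var 8) 5 (.var 8)) r1.1 (k := 8)
      (by simp [fldWrites_traceMul])
    have n2 := run_nat (traceMul 9 5 (.var 8) 5 (.var 8)) r1.1 (k := 8)
      (by simp [natWrites_traceMul])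
    have m2 := run_nat (traceMul 9 5 (.var 8) 5 (.var 8)) r1.1 (k := 0)
      (by simp [natWrites_traceMul])
    generalize (traceMul 9 5 (.var 8) 5 (.var 8)).run r1.1 = r2 at *
    have hd3 : r2.1.nat 0 1 0 0 = d := by rw [m2, hd2]
    obtain ⟨e3, c3⟩ := run_reduceMat r2.1 hd3 hd1
    have q1 : s1.mat d 5 t = s.mat d 5 t := Store.mat_congr (by rw [h5])
    have q2 : r1.1.mat d 5 t = s.mat d 5 t := Store.mat_congr (by rw [f1, h5])
    have q3 : r2.1.mat d 5 t = s.mat d 5 t := Store.mat_congr (by rw [f2, f1, h5])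
    have q4 : r2.1.mat d 7 0 = s1.mat d 7 0 := Store.mat_congr (by rw [g2, g1])
    rw [k2, e1, e2, n2, n1, h8, q1, q2, q3, q4] at e3
    refine ⟨⟨?_, ?_⟩, ?_⟩
    · intro k hk
      rw [e3, mul_sub, Matrix.trace_sub, mul_smul_comm, Matrix.trace_smul, smul_eq_mul]
      rcases Nat.lt_succ_iff_lt_or_eq.1 hk with h | rfl
      · rw [hI.1 k h, horth k (by omega) t ht (by omega)]
        simp
      -- If the denominator vanishes, the stored matrix is itself zero and orthogonality is
      -- automatic, so stored matrices need not be assumed nonzero.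
      · by_cases h0 : ((s.mat d 5 k)ᴴ * s.mat d 5 k).trace = 0
        · rw [Matrix.trace_conjTranspose_mul_self_eq_zero_iff.1 h0]
          simp
        · rw [div_mul_cancel₀ _ h0, sub_self]
    · rw [e3, ← sub_add]
      exact Submodule.add_mem _ hI.2 (Submodule.smul_mem _ _ (Submodule.subset_span ⟨t, ht, rfl⟩))
    · simp only
      omega

/-! ### Adding a word -/

/-- Append to the list the word that arises from the word whose number is the variable `7`
when the letter in the variable `6` is put in front of it. -/
def Prog.appendWord : Prog :=
  seq (setNat 2 (.var 1) (.const 0) (.const 0)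
    (.add (.get 2 (.var 7) (.const 0) (.const 0)) (.const 1)))
  (seq (setNat 3 (.var 1) (.const 0) (.const 0) (.var 6))
  (seq (loop 9 (.get 2 (.var 7) (.const 0) (.const 0))
    (setNat 3 (.var 1) (.add (.var 9) (.const 1)) (.const 0) (.get 3 (.var 7) (.var 9) (.const 0))))
  (setNat 1 (.const 0) (.const 0) (.const 0) (.add (.var 1) (.const 1)))))

theorem Prog.natWrites_appendWord : appendWord.natWrites = [2, 3, 9, 3, 1] := rfl

theorem Prog.fldWrites_appendWord : appendWord.fldWrites = [] := rfl

theorem Prog.run_appendWord (s : Store 𝕜) {m i j N : ℕ} (hm : s.nat 1 0 0 0 = m)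
    (hi : s.nat 6 0 0 0 = i) (hj : s.nat 7 0 0 0 = j) (hjm : j ≠ m)
    (hN : s.nat 2 j 0 0 = N) :
    (appendWord.run s).1.nat 1 0 0 0 = m + 1 ∧
      (∀ j', (appendWord.run s).1.nat 2 j' 0 0 = if j' = m then N + 1 else s.nat 2 j' 0 0) ∧
      (∀ j' p, (appendWord.run s).1.nat 3 j' p 0 = if j' = m ∧ p ≤ N then
        (if p = 0 then i else s.nat 3 j (p - 1) 0) else s.nat 3 j' p 0) ∧
      (appendWord.run s).2 ≤ 50 + N * 50 := by
  rw [appendWord, run_seq, run_seq, run_seq, run_setNat, run_setNat, run_setNat]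
  simp only [NExp.eval]
  rw [hm, hj, hN]
  set s1 := s.setNat 2 m 0 0 (N + 1) with hs1
  have a1 : s1.nat 1 = s.nat 1 := Store.setNat_nat_of_ne _ (by simp) _ _ _ _
  have a6 : s1.nat 6 = s.nat 6 := Store.setNat_nat_of_ne _ (by simp) _ _ _ _
  have a3 : s1.nat 3 = s.nat 3 := Store.setNat_nat_of_ne _ (by simp) _ _ _ _
  have a7 : s1.nat 7 = s.nat 7 := Store.setNat_nat_of_ne _ (by simp) _ _ _ _
  rw [a1, a6, hm, hi]
  set s2 := s1.setNat 3 m 0 0 i with hs2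
  have b1 : s2.nat 1 = s.nat 1 := (Store.setNat_nat_of_ne _ (by simp) _ _ _ _).trans a1
  have b2 : s2.nat 2 = s1.nat 2 := Store.setNat_nat_of_ne _ (by simp) _ _ _ _
  have b7 : s2.nat 7 = s.nat 7 := (Store.setNat_nat_of_ne _ (by simp) _ _ _ _).trans a7
  have hN2 : (NExp.get 2 (.var 7) (.const 0) (.const 0)).eval s2 = N := by
    simp only [NExp.eval, b7, hj, b2, hs1, Store.setNat_nat_self, hN]
    simp [hjm]
  have key := run_loop_of_invariant 9 (.get 2 (.var 7) (.const 0) (.const 0))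
    (setNat 3 (.var 1) (.add (.var 9) (.const 1)) (.const 0) (.get 3 (.var 7) (.var 9) (.const 0)))
    s2 hN2
    -- The first letter is written before the loop, so after `t` rounds the positions `0, …, t` are
    -- in place; hence `p ≤ t`.
    (fun t s' => ∀ j' p, s'.nat 3 j' p 0 = if j' = m ∧ p ≤ t then
        (if p = 0 then i else s.nat 3 j (p - 1) 0) else s.nat 3 j' p 0) 30 ?_ ?_ ?_
  · have c1 := run_nat (loop 9 (.get 2 (.var 7) (.const 0) (.const 0))
      (setNat 3 (.var 1) (.add (.var 9) (.const 1)) (.const 0)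
        (.get 3 (.var 7) (.var 9) (.const 0)))) s2 (k := 1) (by simp [natWrites])
    have c2 := run_nat (loop 9 (.get 2 (.var 7) (.const 0) (.const 0))
      (setNat 3 (.var 1) (.add (.var 9) (.const 1)) (.const 0)
        (.get 3 (.var 7) (.var 9) (.const 0)))) s2 (k := 2) (by simp [natWrites])
    generalize (loop 9 (.get 2 (.var 7) (.const 0) (.const 0))
      (setNat 3 (.var 1) (.add (.var 9) (.const 1)) (.const 0)
        (.get 3 (.var 7) (.var 9) (.const 0)))).run s2 = r at *
    refine ⟨?_, ?_, ?_, ?_⟩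
    · simp [Store.setNat_nat_self, c1, b1, hm]
    · intro j'
      rw [Store.setNat_nat_of_ne _ (by simp), c2, b2, hs1, Store.setNat_nat_self]
      simp
    · intro j' p
      rw [Store.setNat_nat_of_ne _ (by simp)]
      exact key.1 j' p
    · have := key.2
      simp only [NExp.cost] at this ⊢
      omega
  · intro j' p
    rw [hs2, Store.setNat_nat_self, a3]
    by_cases hj' : j' = m
    · by_cases hp : p = 0
      · simp [hj', hp]
      · simp [hp]
    · simp [hj']
  · intro t s' v h j' p
    rw [Store.setNat_nat_of_ne _ (by simp)]
    exact h j' p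
  · intro t ht s' hfr h9 hI
    have d1 : s'.nat 1 0 0 0 = m := by rw [hfr.nat 1 (by simp [natWrites]), b1, hm]
    have d7 : s'.nat 7 0 0 0 = j := by rw [hfr.nat 7 (by simp [natWrites]), b7, hj]
    rw [run_setNat]
    constructor
    · intro j' p
      simp only [NExp.eval, d1, d7, h9, Store.setNat_nat_self, hI]
      by_cases hj' : j' = m
      · by_cases hp : p = t + 1
        · simp [hj', hp, hjm]
        · have : p ≤ t + 1 ↔ p ≤ t := by omega
          simp [hp, this]
      · simp [hj']
    · simp [NExp.cost]

end BasisProgram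

/-! ### One candidate word, and one pass, as programs. -/

section BasisLoop

variable {𝕜 : Type*} [RCLike 𝕜] {n d : ℕ} {A : Fin n → Matrix (Fin d) (Fin d) 𝕜}

/-- The memory holds the list `ws` of words, their values, and an orthogonal basis of the span
of their values. -/
structure Store.Represents (s : Store 𝕜) (A : Fin n → Matrix (Fin d) (Fin d) 𝕜)
    (ws : List (List (Fin n))) : Prop where
  num : s.nat 0 0 0 0 = n
  dim : s.nat 0 1 0 0 = d
  input : ∀ i : Fin n, s.mat d 0 i = A i
  count : s.nat 1 0 0 0 = ws.length
  length : ∀ (j : ℕ) (h : j < ws.length), s.nat 2 j 0 0 = ws[j].length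
  letter : ∀ (j : ℕ) (h : j < ws.length) (p : ℕ) (hp : p < ws[j].length),
    s.nat 3 j p 0 = (ws[j][p] : ℕ)
  value : ∀ (j : ℕ) (h : j < ws.length), s.mat d 4 j = evalWord A ws[j]
  orthogonal : ∀ j < ws.length, ∀ k < ws.length, j ≠ k →
    ((s.mat d 5 j)ᴴ * s.mat d 5 k).trace = 0
  span_eq : Submodule.span 𝕜 {M | ∃ k < ws.length, M = s.mat d 5 k} = wordSpan A ws

/-- The representation uses only the arrays `0` to `3` of natural numbers and the arrays `0`, `4`,
`5` of scalars; the others are scratch space. -/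
theorem Store.Represents.congr {s s' : Store 𝕜} {ws : List (List (Fin n))}
    (h : s.Represents A ws) (hn : ∀ k ≤ 3, s'.nat k = s.nat k)
    (h0 : s'.fld 0 = s.fld 0) (h4 : s'.fld 4 = s.fld 4) (h5 : s'.fld 5 = s.fld 5) :
    s'.Represents A ws := by
  have m0 : s'.mat d 0 = s.mat d 0 := funext fun i => Store.mat_congr (by rw [h0])
  have m4 : s'.mat d 4 = s.mat d 4 := funext fun i => Store.mat_congr (by rw [h4])
  have m5 : s'.mat d 5 = s.mat d 5 := funext fun i => Store.mat_congr (by rw [h5])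
  refine ⟨?_, ?_, ?_, ?_, ?_, ?_, ?_, ?_, ?_⟩
  · rw [hn 0 (by simp), h.num]
  · rw [hn 0 (by simp), h.dim]
  · rw [m0]; exact h.input
  · rw [hn 1 (by simp), h.count]
  · rw [hn 2 (by simp)]; exact h.length
  · rw [hn 3 (by simp)]; exact h.letter
  · rw [m4]; exact h.value
  · rw [m5]; exact h.orthogonal
  · rw [m5]; exact h.span_eq

/-- Try to append the word whose letters are the letter in the variable `6` and those of the word
whose number is the variable `7`. -/
def Prog.tryWord : Prog :=
  seq (mulMat 0 (.var 6) 4 (.var 7))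
  (seq (copyMat 7 (.const 0) 6 (.const 0))
  (seq orthogonalize
  (seq (traceMul 8 7 (.const 0) 7 (.const 0))
  (ifZero (.var 8) skip
    (seq (copyMat 4 (.var 1) 6 (.const 0))
    (seq (copyMat 5 (.var 1) 7 (.const 0)) appendWord))))))

/-- Variable `6` is the letter of the outer loop and variable `12` the length of the list at the
start of the pass; both must survive a trial. -/
theorem Prog.natWrites_tryWord (k : ℕ) (hk : k = 6 ∨ k = 12) :
    k ∉ Prog.tryWord.natWrites := by
  have : Prog.tryWord.natWrites = [9, 10, 11, 9, 10, 8, 9, 10, 9, 10, 9, 10, 9, 10, 9, 10, 9, 10,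
    2, 3, 9, 3, 1] := rfl
  rw [this]
  rcases hk with rfl | rfl <;> simp

/-- The memory after a word has been appended. -/
theorem Store.Represents.append {s s' : Store 𝕜} {ws : List (List (Fin n))}
    (h : s.Represents A ws) (i : Fin n) {j : ℕ} (hj : j < ws.length)
    (hn : s'.nat 0 = s.nat 0) (hf : s'.fld 0 = s.fld 0)
    (hc : s'.nat 1 0 0 0 = ws.length + 1)
    (hl : ∀ j', s'.nat 2 j' 0 0 = if j' = ws.length then ws[j].length + 1 else s.nat 2 j' 0 0)
    (hw : ∀ j' p, s'.nat 3 j' p 0 = if j' = ws.length ∧ p ≤ ws[j].length then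
        (if p = 0 then (i : ℕ) else s.nat 3 j (p - 1) 0) else s.nat 3 j' p 0)
    (h4 : ∀ j' ≠ ws.length, s'.fld 4 j' = s.fld 4 j')
    (h4' : s'.mat d 4 ws.length = evalWord A (i :: ws[j]))
    (h5 : ∀ j' ≠ ws.length, s'.fld 5 j' = s.fld 5 j')
    (h5' : ∀ k < ws.length, ((s.mat d 5 k)ᴴ * s'.mat d 5 ws.length).trace = 0)
    (hsp : evalWord A (i :: ws[j]) - s'.mat d 5 ws.length ∈ wordSpan A ws) :
    s'.Represents A (ws ++ [i :: ws[j]]) := by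
  have m4 : ∀ k < ws.length, s'.mat d 4 k = s.mat d 4 k := fun k hk =>
    Store.mat_congr (h4 k (by omega))
  have m5 : ∀ k < ws.length, s'.mat d 5 k = s.mat d 5 k := fun k hk =>
    Store.mat_congr (h5 k (by omega))
  have hcase : ∀ k, k < (ws ++ [i :: ws[j]]).length → k < ws.length ∨ k = ws.length := by
    intro k hk
    rw [List.length_append, List.length_singleton] at hk
    omega
  refine ⟨?_, ?_, ?_, ?_, ?_, ?_, ?_, ?_, ?_⟩
  · rw [hn, h.num]
  · rw [hn, h.dim]
  · intro i
    rw [← h.input i]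
    exact Store.mat_congr (by rw [hf])
  · rw [hc, List.length_append, List.length_singleton]
  · intro k hk
    rw [hl]
    rcases hcase k hk with h1 | rfl
    · rw [if_neg (by omega), h.length k h1, List.getElem_append_left h1]
    · rw [if_pos rfl, List.getElem_concat_length rfl]
      rfl
  · intro k hk p hp
    rw [hw]
    rcases hcase k hk with h1 | rfl
    · rw [if_neg (by omega)]
      simp only [List.getElem_append_left h1] at hp ⊢
      exact h.letter k h1 p hp
    · simp only [List.getElem_concat_length] at hp ⊢
      rw [List.length_cons] at hp
      rw [if_pos ⟨trivial, by omega⟩]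
      cases p with
      | zero => simp
      | succ p =>
        rw [if_neg (by omega)]
        exact h.letter j hj p (by omega)
  · intro k hk
    rcases hcase k hk with h1 | rfl
    · rw [m4 k h1, h.value k h1, List.getElem_append_left h1]
    · rw [h4', List.getElem_concat_length rfl]
  · intro k hk l hl hkl
    rcases hcase k hk with h1 | rfl <;> rcases hcase l hl with h2 | rfl
    · rw [m5 k h1, m5 l h2]
      exact h.orthogonal k h1 l h2 hkl
    · rw [m5 k h1]
      exact h5' k h1
    · rw [m5 l h2]
      have := congrArg star (h5' l h2)
      rw [← Matrix.trace_conjTranspose] at this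
      simpa using this
    · exact absurd rfl hkl
  · have hset : {M | ∃ k < (ws ++ [i :: ws[j]]).length, M = s'.mat d 5 k} =
        {M | ∃ k < ws.length, M = s.mat d 5 k} ∪ {s'.mat d 5 ws.length} := by
      ext M
      constructor
      · rintro ⟨k, hk, rfl⟩
        rcases hcase k hk with h1 | rfl
        · exact Or.inl ⟨k, h1, m5 k h1⟩
        · exact Or.inr rfl
      · rintro (⟨k, hk, rfl⟩ | rfl)
        · exact ⟨k, by rw [List.length_append]; omega, (m5 k hk).symm⟩
        · exact ⟨ws.length, by simp, rfl⟩
    -- The value of the new word and its residual differ by an element of the old span, so adjoining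
    -- either one gives the same span.
    rw [hset, Submodule.span_union, h.span_eq, wordSpan_append_singleton]
    set E := evalWord A (i :: ws[j])
    set R := s'.mat d 5 ws.length
    apply le_antisymm
    · refine sup_le le_sup_left ?_
      rw [Submodule.span_singleton_le_iff_mem]
      have : R = -(E - R) + E := by abel
      rw [this]
      exact Submodule.add_mem _ (Submodule.mem_sup_left (Submodule.neg_mem _ hsp))
        (Submodule.mem_sup_right (Submodule.mem_span_singleton_self _))
    · refine sup_le le_sup_left ?_
      rw [Submodule.span_singleton_le_iff_mem]
      have : E = (E - R) + R := by abel
      rw [this]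
      exact Submodule.add_mem _ (Submodule.mem_sup_left hsp)
        (Submodule.mem_sup_right (Submodule.mem_span_singleton_self _))

-- The zero test that decides linear dependence: `E` lies in the span exactly if its residual `R`
-- does, and `R` is orthogonal to the span, so it would be orthogonal to itself.
open scoped ComplexOrder in
theorem mem_wordSpan_iff_of_orthogonal {s : Store 𝕜} {ws : List (List (Fin n))}
    (h : s.Represents A ws) {E R : Matrix (Fin d) (Fin d) 𝕜} (hR : E - R ∈ wordSpan A ws)
    (horth : ∀ k < ws.length, ((s.mat d 5 k)ᴴ * R).trace = 0) :
    E ∈ wordSpan A ws ↔ (Rᴴ * R).trace = 0 := by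
  constructor
  · intro hE
    have hRm : R ∈ wordSpan A ws := by
      have := Submodule.sub_mem _ hE hR
      rwa [sub_sub_cancel] at this
    have key : ∀ X ∈ Submodule.span 𝕜 {M | ∃ k < ws.length, M = s.mat d 5 k},
        (Xᴴ * R).trace = 0 := by
      intro X hX
      induction hX using Submodule.span_induction with
      | mem z hz =>
        obtain ⟨k, hk, rfl⟩ := hz
        exact horth k hk
      | zero => simp
      | add x y _ _ hx hy => rw [conjTranspose_add, add_mul, Matrix.trace_add, hx, hy, add_zero]
      | smul c x _ hx => rw [conjTranspose_smul, smul_mul_assoc, Matrix.trace_smul, hx, smul_zero]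
    exact key R (h.span_eq ▸ hRm)
  · intro h0
    rw [Matrix.trace_conjTranspose_mul_self_eq_zero_iff.1 h0, sub_zero] at hR
    exact hR

/-- Gram–Schmidt dominates the cost: at most `d²` stored matrices with `d²` entries each. Copying
the word is cheap because its length is below that of the list. -/
theorem Prog.run_tryWord {s : Store 𝕜} {ws : List (List (Fin n))} (h : s.Represents A ws)
    (hws : IsShortIndependent A ws) (hd1 : 1 ≤ d) (i : Fin n) {j : ℕ} (hj : j < ws.length)
    (h6 : s.nat 6 0 0 0 = i) (h7 : s.nat 7 0 0 0 = j) :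
    (Prog.tryWord.run s).1.Represents A (_root_.tryWord A ws (i :: ws[j])) ∧
      (Prog.tryWord.run s).2 ≤ 1000 * d ^ 4 := by
  have p1 : 1 ≤ d ^ 4 := Nat.one_le_pow _ _ hd1
  have p2 : d ^ 2 ≤ d ^ 4 := Nat.pow_le_pow_right hd1 (by omega)
  have p3 : d ^ 3 ≤ d ^ 4 := Nat.pow_le_pow_right hd1 (by omega)
  have hm : ws.length ≤ d ^ 2 := hws.length_le.trans (le_of_eq (sq d).symm)
  rw [Prog.tryWord, run_seq, run_seq, run_seq, run_seq]
  obtain ⟨e1, c1⟩ := run_mulMat s h.dim hd1 (ka := 0) (kb := 4) (ia := .var 6) (ib := .var 7)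
    (i := i) (j := j) (by simp) (by simp)
    (fun s' hs' => by rw [NExp.eval_var, hs' 6 (by simp) (by simp) (by simp), h6])
    (fun s' hs' => by rw [NExp.eval_var, hs' 7 (by simp) (by simp) (by simp), h7])
    (by simp [NExp.cost]) (by simp [NExp.cost])
  rw [h.input, h.value j hj, ← evalWord_cons] at e1
  have n1 : ∀ k, k ≠ 9 → k ≠ 10 → k ≠ 11 →
      ((mulMat 0 (.var 6) 4 (.var 7)).run s).1.nat k = s.nat k := fun k hk1 hk2 hk3 =>
    run_nat _ _ (by simp [natWrites_mulMat, hk1, hk2, hk3])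
  have f1 : ∀ k, k ≠ 6 → ((mulMat 0 (.var 6) 4 (.var 7)).run s).1.fld k = s.fld k := fun k hk =>
    run_fld _ _ (by simp [fldWrites_mulMat, hk])
  generalize (mulMat 0 (.var 6) 4 (.var 7)).run s = r1 at *
  obtain ⟨e2, -, c2⟩ := run_copyMat r1.1 (d := d)
    (by rw [n1 0 (by simp) (by simp) (by simp), h.dim]) hd1 (ka := 7)
    (kb := 6) (ia := .const 0) (ib := .const 0) (i := 0) (j := 0) (by simp) (fun _ _ => rfl)
    (fun _ _ => rfl) (by simp [NExp.cost]) (by simp [NExp.cost])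
  have n2 : ∀ k, k ≠ 9 → k ≠ 10 → ((copyMat 7 (.const 0) 6 (.const 0)).run r1.1).1.nat k =
      r1.1.nat k := fun k hk1 hk2 =>
    run_nat _ _ (by simp [natWrites_copyMat, hk1, hk2])
  have f2 : ∀ k, k ≠ 7 → ((copyMat 7 (.const 0) 6 (.const 0)).run r1.1).1.fld k =
      r1.1.fld k := fun k hk => run_fld _ _ (by simp [fldWrites_copyMat, hk])
  rw [e1] at e2
  generalize (copyMat 7 (.const 0) 6 (.const 0)).run r1.1 = r2 at *
  have n2' : ∀ k, k ≠ 9 → k ≠ 10 → k ≠ 11 → r2.1.nat k = s.nat k := fun k hk1 hk2 hk3 => by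
    rw [n2 k hk1 hk2, n1 k hk1 hk2 hk3]
  have q2 : ∀ k, r2.1.mat d 5 k = s.mat d 5 k := fun k =>
    Store.mat_congr (by rw [f2 5 (by simp), f1 5 (by simp)])
  obtain ⟨⟨e3, e3'⟩, c3⟩ := run_orthogonalize r2.1 (d := d) (m := ws.length)
    (by rw [n2' 0 (by simp) (by simp) (by simp), h.dim]) hd1
    (by rw [n2' 1 (by simp) (by simp) (by simp), h.count]) hws.length_le
    (by simp only [q2]; exact h.orthogonal)
  have n3 : ∀ k, k ≠ 8 → k ≠ 9 → k ≠ 10 → (orthogonalize.run r2.1).1.nat k =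
      r2.1.nat k := fun k hk1 hk2 hk3 =>
    run_nat _ _ (by simp [natWrites_orthogonalize, hk1, hk2, hk3])
  have f3 : ∀ k, k ≠ 7 → k ≠ 8 → k ≠ 9 → (orthogonalize.run r2.1).1.fld k =
      r2.1.fld k := fun k hk1 hk2 hk3 =>
    run_fld _ _ (by simp [fldWrites_orthogonalize, hk1, hk2, hk3])
  simp only [q2, e2, h.span_eq] at e3 e3'
  generalize orthogonalize.run r2.1 = r3 at *
  have n3' : ∀ k, k ≠ 8 → k ≠ 9 → k ≠ 10 → k ≠ 11 → r3.1.nat k = s.nat k :=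
    fun k hk0 hk1 hk2 hk3 => by rw [n3 k hk0 hk1 hk2, n2' k hk1 hk2 hk3]
  obtain ⟨e4, c4⟩ := run_traceMul r3.1 (d := d)
    (by rw [n3' 0 (by simp) (by simp) (by simp) (by simp), h.dim]) hd1 (acc := 8) (ka := 7)
    (kb := 7) (ia := .const 0) (ib := .const 0) (i := 0) (j := 0) (by simp) (by simp)
    (fun _ _ => rfl) (fun _ _ => rfl) (by simp [NExp.cost]) (by simp [NExp.cost])
  have n4 : ∀ k, k ≠ 9 → k ≠ 10 → ((traceMul 8 7 (.const 0) 7 (.const 0)).run r3.1).1.nat k =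
      r3.1.nat k := fun k hk1 hk2 =>
    run_nat _ _ (by simp [natWrites_traceMul, hk1, hk2])
  have f4 : ∀ k, k ≠ 8 → ((traceMul 8 7 (.const 0) 7 (.const 0)).run r3.1).1.fld k =
      r3.1.fld k := fun k hk => run_fld _ _ (by simp [fldWrites_traceMul, hk])
  generalize (traceMul 8 7 (.const 0) 7 (.const 0)).run r3.1 = r4 at *
  have n4' : ∀ k, k ≠ 8 → k ≠ 9 → k ≠ 10 → k ≠ 11 → r4.1.nat k = s.nat k :=
    fun k hk0 hk1 hk2 hk3 => by rw [n4 k hk1 hk2, n3' k hk0 hk1 hk2 hk3]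
  have f4' : ∀ k, k ≠ 6 → k ≠ 7 → k ≠ 8 → k ≠ 9 → r4.1.fld k = s.fld k :=
    fun k hk0 hk1 hk2 hk3 => by
      rw [f4 k hk2, f3 k hk1 hk2 hk3, f2 k hk1, f1 k hk0]
  have hiff := mem_wordSpan_iff_of_orthogonal h e3' e3
  rw [← e4] at hiff
  rw [run]
  have hev : (FExp.var 8).eval r4.1 = r4.1.fld 8 0 0 0 := rfl
  rw [hev]
  by_cases hz : r4.1.fld 8 0 0 0 = 0
  · rw [if_pos hz, _root_.tryWord, if_pos (hiff.2 hz), run]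
    constructor
    · refine h.congr (fun k hk => n4' k (by omega) (by omega) (by omega) (by omega)) ?_ ?_ ?_ <;>
        exact f4' _ (by simp) (by simp) (by simp) (by simp)
    · simp only [FExp.cost, NExp.cost]
      omega
  · rw [if_neg hz, _root_.tryWord, if_neg fun hmem => hz (hiff.1 hmem), run_seq, run_seq]
    have hvar : ∀ s1 : Store 𝕜, s1.nat 1 = s.nat 1 → ∀ s' : Store 𝕜,
        (∀ k, k ≠ 9 → k ≠ 10 → s'.nat k = s1.nat k) → (NExp.var 1).eval s' = ws.length := by
      intro s1 h1 s' h'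
      rw [NExp.eval_var, h' 1 (by simp) (by simp), h1, h.count]
    obtain ⟨e5, g5, c5⟩ := run_copyMat r4.1 (d := d)
      (by rw [n4' 0 (by simp) (by simp) (by simp) (by simp), h.dim]) hd1 (ka := 4)
      (kb := 6) (ia := .var 1) (ib := .const 0) (i := ws.length) (j := 0) (by simp)
      (hvar _ (n4' 1 (by simp) (by simp) (by simp) (by simp)))
      (fun _ _ => rfl) (by simp [NExp.cost]) (by simp [NExp.cost])
    have n5 : ∀ k, k ≠ 9 → k ≠ 10 → ((copyMat 4 (.var 1) 6 (.const 0)).run r4.1).1.nat k =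
        r4.1.nat k := fun k hk1 hk2 =>
      run_nat _ _ (by simp [natWrites_copyMat, hk1, hk2])
    have f5 : ∀ k, k ≠ 4 → ((copyMat 4 (.var 1) 6 (.const 0)).run r4.1).1.fld k =
        r4.1.fld k := fun k hk => run_fld _ _ (by simp [fldWrites_copyMat, hk])
    generalize (copyMat 4 (.var 1) 6 (.const 0)).run r4.1 = r5 at *
    have n5' : ∀ k, k ≠ 8 → k ≠ 9 → k ≠ 10 → k ≠ 11 → r5.1.nat k = s.nat k :=
      fun k hk0 hk1 hk2 hk3 => by rw [n5 k hk1 hk2, n4' k hk0 hk1 hk2 hk3]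
    obtain ⟨e6, g6, c6⟩ := run_copyMat r5.1 (d := d)
      (by rw [n5' 0 (by simp) (by simp) (by simp) (by simp), h.dim]) hd1 (ka := 5)
      (kb := 7) (ia := .var 1) (ib := .const 0) (i := ws.length) (j := 0) (by simp)
      (hvar _ (n5' 1 (by simp) (by simp) (by simp) (by simp)))
      (fun _ _ => rfl) (by simp [NExp.cost]) (by simp [NExp.cost])
    have n6 : ∀ k, k ≠ 9 → k ≠ 10 → ((copyMat 5 (.var 1) 7 (.const 0)).run r5.1).1.nat k =
        r5.1.nat k := fun k hk1 hk2 =>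
      run_nat _ _ (by simp [natWrites_copyMat, hk1, hk2])
    have f6 : ∀ k, k ≠ 5 → ((copyMat 5 (.var 1) 7 (.const 0)).run r5.1).1.fld k =
        r5.1.fld k := fun k hk => run_fld _ _ (by simp [fldWrites_copyMat, hk])
    generalize (copyMat 5 (.var 1) 7 (.const 0)).run r5.1 = r6 at *
    have n6' : ∀ k, k ≠ 8 → k ≠ 9 → k ≠ 10 → k ≠ 11 → r6.1.nat k = s.nat k :=
      fun k hk0 hk1 hk2 hk3 => by rw [n6 k hk1 hk2, n5' k hk0 hk1 hk2 hk3]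
    obtain ⟨e7, l7, w7, c7⟩ := run_appendWord r6.1 (m := ws.length) (i := i) (j := j)
      (N := ws[j].length)
      (by rw [n6' 1 (by simp) (by simp) (by simp) (by simp), h.count])
      (by rw [n6' 6 (by simp) (by simp) (by simp) (by simp), h6])
      (by rw [n6' 7 (by simp) (by simp) (by simp) (by simp), h7]) (by omega)
      (by rw [n6' 2 (by simp) (by simp) (by simp) (by simp), h.length j hj])
    have n7 : (appendWord.run r6.1).1.nat 0 = r6.1.nat 0 :=
      run_nat _ _ (by simp [natWrites_appendWord])
    have f7 : ∀ k, (appendWord.run r6.1).1.fld k = r6.1.fld k := fun k =>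
      run_fld _ _ (by simp [fldWrites_appendWord])
    generalize appendWord.run r6.1 = r7 at *
    rw [n6' 2 (by simp) (by simp) (by simp) (by simp)] at l7
    rw [n6' 3 (by simp) (by simp) (by simp) (by simp)] at w7
    have hE : r4.1.mat d 6 0 = evalWord A (i :: ws[j]) := by
      rw [← e1]
      exact Store.mat_congr (by
        rw [f4 6 (by simp), f3 6 (by simp) (by simp) (by simp), f2 6 (by simp)])
    have hR : r7.1.mat d 5 ws.length = r3.1.mat d 7 0 := by
      rw [Store.mat_congr (s' := r6.1) (by rw [f7]), e6]
      exact Store.mat_congr (by rw [f5 7 (by simp), f4 7 (by simp)])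
    constructor
    · refine h.append i hj ?_ ?_ e7 l7 w7 ?_ ?_ ?_ ?_ ?_
      · rw [n7, n6' 0 (by simp) (by simp) (by simp) (by simp)]
      · rw [f7, f6 0 (by simp), f5 0 (by simp), f4' 0 (by simp) (by simp) (by simp) (by simp)]
      · intro j' hj'
        rw [f7, f6 4 (by simp), g5 j' hj', f4' 4 (by simp) (by simp) (by simp) (by simp)]
      · rw [Store.mat_congr (s' := r5.1) (by rw [f7, f6 4 (by simp)]), e5, hE]
      · intro j' hj'
        rw [f7, g6 j' hj', f5 5 (by simp), f4' 5 (by simp) (by simp) (by simp) (by simp)]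
      · rw [hR]
        exact e3
      · rw [hR]
        exact e3'
    · have := hws.length_word_lt _ (List.getElem_mem hj)
      simp only [FExp.cost, NExp.cost]
      omega

/-- One pass over the list of words. -/
def Prog.basisPass : Prog :=
  seq (setNat 12 (.const 0) (.const 0) (.const 0) (.var 1))
    (loop 6 (.var 0) (loop 7 (.var 12) Prog.tryWord))

theorem Prog.run_basisPass {s : Store 𝕜} {ws : List (List (Fin n))} (h : s.Represents A ws)
    (hws : IsShortIndependent A ws) (hd1 : 1 ≤ d) :
    (Prog.basisPass.run s).1.Represents A (_root_.basisPass A ws) ∧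
      (Prog.basisPass.run s).2 ≤ 20 + n * (1010 * d ^ 6) := by
  have p1 : 1 ≤ d ^ 4 := Nat.one_le_pow _ _ hd1
  have p6 : 1 ≤ d ^ 6 := Nat.one_le_pow _ _ hd1
  rw [Prog.basisPass, run_seq, run_setNat]
  simp only [NExp.eval]
  rw [h.count]
  -- The word count grows during the pass, so the inner loop needs the initial length kept in a
  -- separate variable.
  set s0 := s.setNat 12 0 0 0 ws.length with hs0
  have hk0 : ∀ k, k ≠ 12 → s0.nat k = s.nat k := fun k hk =>
    Store.setNat_nat_of_ne _ hk _ _ _ _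
  have h0 : s0.Represents A ws := h.congr (fun k hk => hk0 k (by omega)) rfl rfl rfl
  have h12 : s0.nat 12 0 0 0 = ws.length := by simp [hs0, Store.setNat_nat_self]
  -- The candidates with one of the first `a` letters in front, in the order in which the pass tries
  -- them.
  let cands : ℕ → List (List (Fin n)) := fun a =>
    ((List.finRange n).take a).flatMap fun i => ws.map fun w => i :: w
  have hrep : ∀ k, k = 6 ∨ k = 7 → ∀ vs (s' : Store 𝕜) v, s'.Represents A vs →
      (s'.setNat k 0 0 0 v).Represents A vs := fun k hk vs s' v h' =>
    h'.congr (fun l hl => Store.setNat_nat_of_ne _ (by omega) _ _ _ _) rfl rfl rfl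
  have hgood : ∀ cs : List (List (Fin n)), (∀ c ∈ cs, ∃ i, ∃ w ∈ ws, c = i :: w) →
      IsShortIndependent A (cs.foldl (_root_.tryWord A) ws) := fun cs hcs =>
    hws.foldl (List.Subset.refl _) cs hcs
  have key := run_loop_of_invariant 6 (.var 0) (loop 7 (.var 12) Prog.tryWord) s0 h0.num
    (fun a s' => s'.Represents A ((cands a).foldl (_root_.tryWord A) ws)) (1009 * d ^ 6)
    (by simpa [cands] using h0) (fun _ _ _ h' => hrep 6 (Or.inl rfl) _ _ _ h') ?_
  · have hc : cands n = (List.finRange n).flatMap fun i => ws.map fun w => i :: w := by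
      simp only [cands]
      rw [List.take_of_length_le (by simp)]
    rw [hc] at key
    refine ⟨key.1, ?_⟩
    have h2 := key.2
    have h3 : n * (1009 * d ^ 6 + 1) ≤ n * (1010 * d ^ 6) := Nat.mul_le_mul_left _ (by omega)
    simp only [NExp.cost] at h2 ⊢
    omega
  · intro a ha s1 hfr1 h6 hI
    have hs12 : (NExp.var 12).eval s1 = ws.length := by
      rw [NExp.eval_var, hfr1.nat 12, h12]
      simp only [natWrites, List.mem_cons, not_or]
      exact ⟨by simp, by simp, natWrites_tryWord 12 (by simp)⟩
    set vs := (cands a).foldl (_root_.tryWord A) ws with hvs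
    have hcands : ∀ b, ∀ c ∈ cands a ++ (ws.take b).map (fun w => (⟨a, ha⟩ : Fin n) :: w),
        ∃ i, ∃ w ∈ ws, c = i :: w := by
      intro b c hc
      rcases List.mem_append.1 hc with hc | hc
      · simp only [cands, List.mem_flatMap, List.mem_map] at hc
        obtain ⟨i, -, w, hw, rfl⟩ := hc
        exact ⟨i, w, hw, rfl⟩
      · obtain ⟨w, hw, rfl⟩ := List.mem_map.1 hc
        exact ⟨_, w, List.mem_of_mem_take hw, rfl⟩
    have key := run_loop_of_invariant 7 (.var 12) Prog.tryWord s1 hs12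
      (fun b s' => s'.Represents A
        ((cands a ++ (ws.take b).map fun w => (⟨a, ha⟩ : Fin n) :: w).foldl
          (_root_.tryWord A) ws)) (1000 * d ^ 4)
      (by simpa using hI) (fun _ _ _ h' => hrep 7 (Or.inr rfl) _ _ _ h') ?_
    · constructor
      · have hc : cands (a + 1) = cands a ++ ws.map fun w => (⟨a, ha⟩ : Fin n) :: w := by
          simp only [cands]
          rw [List.take_succ_eq_append_getElem (by simpa using ha), List.flatMap_append]
          simp
        rw [hc]
        simpa using key.1
      · refine key.2.trans ?_
        simp only [NExp.cost]
        have h1 : ws.length * (1000 * d ^ 4 + 1) ≤ (d * d) * (1001 * d ^ 4) :=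
          Nat.mul_le_mul hws.length_le (by omega)
        have h2 : (d * d) * (1001 * d ^ 4) = 1001 * d ^ 6 := by ring
        omega
    · intro b hb s2 hfr2 h7 hI2
      have hg := hgood _ (hcands b)
      have hpre : ws <+: (cands a ++ (ws.take b).map fun w => (⟨a, ha⟩ : Fin n) :: w).foldl
          (_root_.tryWord A) ws := prefix_foldl_tryWord A _ _
      set us := (cands a ++ (ws.take b).map fun w => (⟨a, ha⟩ : Fin n) :: w).foldl
          (_root_.tryWord A) ws with hus
      have hbu : b < us.length := lt_of_lt_of_le hb hpre.length_le
      -- Words are only appended, so word number `b` of the growing list is still word number `b` of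
      -- the list at the start of the pass.
      have hub : us[b] = ws[b] := (hpre.getElem hb).symm
      have := run_tryWord hI2 hg hd1 ⟨a, ha⟩ hbu
        (by
          rw [hfr2.nat 6, h6]
          simp only [natWrites, List.mem_cons, not_or]
          exact ⟨by simp, natWrites_tryWord 6 (by simp)⟩) h7
      refine ⟨?_, this.2⟩
      have h1 := this.1
      rw [hub] at h1
      rw [List.take_succ_eq_append_getElem hb, List.map_append, ← List.append_assoc,
        List.foldl_append, ← hus]
      exact h1

end BasisLoop

/-! ### The complete program: initialization, passes, trace tables, total cost. -/

section TraceProgram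

variable {𝕜 : Type*} [RCLike 𝕜] {n d : ℕ} {A : Fin n → Matrix (Fin d) (Fin d) 𝕜}

/-- Put the identity matrix at place `0` into the arrays `4` and `5`, record that there is one
word, and put the dimension of the matrix algebra into the variable `4`. -/
def Prog.setup : Prog :=
  seq (loop 9 .dim (seq (setFld 4 (.const 0) (.var 9) (.var 9) .one)
    (setFld 5 (.const 0) (.var 9) (.var 9) .one)))
  (seq (loop 9 .dim (setNat 4 (.const 0) (.const 0) (.const 0) (.add (.var 4) .dim)))
  (setNat 1 (.const 0) (.const 0) (.const 0) (.const 1)))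

theorem inputStore_mat (r : ℕ) (A : Fin n → Matrix (Fin d) (Fin d) 𝕜) (i : Fin n) :
    (inputStore r A).mat d 0 i = A i := by
  ext a b
  rw [Store.mat_apply]
  simp [inputStore]

theorem inputStore_fld_of_ne (r : ℕ) (A : Fin n → Matrix (Fin d) (Fin d) 𝕜) {k : ℕ} (hk : k ≠ 0)
    (i a b : ℕ) : (inputStore r A).fld k i a b = 0 := by
  simp [inputStore, hk]

theorem inputStore_nat_of_ne (r : ℕ) (A : Fin n → Matrix (Fin d) (Fin d) 𝕜) {k : ℕ} (hk : k ≠ 0)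
    (i a b : ℕ) : (inputStore r A).nat k i a b = 0 := by
  simp [inputStore, hk]

theorem Prog.run_setup (r : ℕ) (A : Fin n → Matrix (Fin d) (Fin d) 𝕜) :
    (setup.run (inputStore r A)).1.Represents A [[]] ∧
      (setup.run (inputStore r A)).1.nat 4 0 0 0 = d * d ∧
      (setup.run (inputStore r A)).2 ≤ 50 + 100 * d := by
  set s := inputStore r A with hs
  have hd : s.nat 0 1 0 0 = d := by simp [hs, inputStore]
  have hn : s.nat 0 0 0 0 = n := by simp [hs, inputStore]
  rw [setup, run_seq, run_seq, run_setNat]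
  have key := run_loop_of_invariant 9 .dim (seq (setFld 4 (.const 0) (.var 9) (.var 9) .one)
    (setFld 5 (.const 0) (.var 9) (.var 9) .one)) s hd
    (fun t s' => ∀ k, k = 4 ∨ k = 5 → ∀ i a b, s'.fld k i a b =
      if i = 0 ∧ a = b ∧ a < t then 1 else 0) 40 ?_ (fun _ _ _ h => h) ?_
  · have n1 : ∀ k, k ≠ 9 → ((loop 9 .dim (seq (setFld 4 (.const 0) (.var 9) (.var 9) .one)
        (setFld 5 (.const 0) (.var 9) (.var 9) .one))).run s).1.nat k = s.nat k := fun k hk =>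
      run_nat _ _ (by simp [natWrites, hk])
    have f1 : ∀ k, k ≠ 4 → k ≠ 5 → ((loop 9 .dim (seq (setFld 4 (.const 0) (.var 9) (.var 9) .one)
        (setFld 5 (.const 0) (.var 9) (.var 9) .one))).run s).1.fld k = s.fld k :=
      fun k hk hk' => run_fld _ _ (by simp [fldWrites, hk, hk'])
    generalize (loop 9 .dim (seq (setFld 4 (.const 0) (.var 9) (.var 9) .one)
      (setFld 5 (.const 0) (.var 9) (.var 9) .one))).run s = r1 at *
    have hd1 : NExp.dim.eval r1.1 = d := by rw [NExp.eval_dim, n1 0 (by simp), hd]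
    -- Expressions for natural numbers have no product, so `d * d` is built by adding `d`
    -- repeatedly.
    have key2 := run_loop_of_invariant 9 .dim
      (setNat 4 (.const 0) (.const 0) (.const 0) (.add (.var 4) .dim)) r1.1 hd1
      (fun t s' => s'.nat 4 0 0 0 = t * d) 20 ?_ ?_ ?_
    · have n2 : ∀ k, k ≠ 4 → k ≠ 9 → ((loop 9 .dim (setNat 4 (.const 0) (.const 0) (.const 0)
          (.add (.var 4) .dim))).run r1.1).1.nat k = r1.1.nat k := fun k hk hk' =>
        run_nat _ _ (by simp [natWrites, hk, hk'])
      have f2 : ∀ k, ((loop 9 .dim (setNat 4 (.const 0) (.const 0) (.const 0)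
          (.add (.var 4) .dim))).run r1.1).1.fld k = r1.1.fld k := fun k =>
        run_fld _ _ (by simp [fldWrites])
      generalize (loop 9 .dim (setNat 4 (.const 0) (.const 0) (.const 0)
        (.add (.var 4) .dim))).run r1.1 = r2 at *
      simp only [NExp.eval]
      have n3 : ∀ k, k ≠ 1 → k ≠ 4 → k ≠ 9 → (r2.1.setNat 1 0 0 0 1).nat k = s.nat k :=
        fun k h1 h2 h3 => by rw [Store.setNat_nat_of_ne _ h1, n2 k h2 h3, n1 k h3]
      have hone : ∀ k, k = 4 ∨ k = 5 → (r2.1.setNat 1 0 0 0 1).mat d k 0 = 1 := by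
        intro k hk
        ext a b
        rw [Store.mat_apply, Store.setNat_fld, f2, key.1 k hk, Matrix.one_apply]
        simp [Fin.ext_iff]
      have h0 : ∀ j, j < [([] : List (Fin n))].length → j = 0 := by
        intro j hj
        simpa using hj
      refine ⟨⟨?_, ?_, ?_, ?_, ?_, ?_, ?_, ?_, ?_⟩, ?_, ?_⟩
      · rw [n3 0 (by simp) (by simp) (by simp), hn]
      · rw [n3 0 (by simp) (by simp) (by simp), hd]
      · intro i
        rw [← inputStore_mat r A i]
        exact Store.mat_congr (by rw [Store.setNat_fld, f2, f1 0 (by simp) (by simp)])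
      · simp [Store.setNat_nat_self]
      · intro j hj
        obtain rfl := h0 j hj
        rw [n3 2 (by simp) (by simp) (by simp)]
        exact inputStore_nat_of_ne r A (by simp) _ _ _
      · intro j hj p hp
        obtain rfl := h0 j hj
        simp at hp
      · intro j hj
        obtain rfl := h0 j hj
        exact hone 4 (Or.inl rfl)
      · intro j hj k hk hjk
        exact absurd ((h0 j hj).trans (h0 k hk).symm) hjk
      · rw [wordSpan]
        congr 1
        ext M
        constructor
        · rintro ⟨k, hk, rfl⟩
          obtain rfl := h0 k hk
          exact ⟨[], by simp, hone 5 (Or.inr rfl)⟩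
        · rintro ⟨w, hw, rfl⟩
          obtain rfl := List.mem_singleton.1 hw
          exact ⟨0, by simp, (hone 5 (Or.inr rfl)).symm⟩
      · rw [Store.setNat_nat_of_ne _ (by simp)]
        exact key2.1
      · have h1 := key.2
        have h2 := key2.2
        simp only [NExp.cost] at h1 h2 ⊢
        omega
    · rw [n1 4 (by simp), hs, inputStore_nat_of_ne r A (by simp)]
      simp
    · intro t s' v h
      rw [Store.setNat_nat_of_ne _ (by simp)]
      exact h
    · intro t ht s' hfr h9 hI
      rw [run_setNat]
      constructor
      · simp only [NExp.eval]
        rw [Store.setNat_nat_self, hI, hfr.nat 0 (by simp [natWrites]), n1 0 (by simp), hd]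
        simp [add_mul]
      · simp [NExp.cost]
  · intro k hk i a b
    rw [hs, inputStore_fld_of_ne r A (by omega)]
    simp
  · intro t ht s' hfr h9 hI
    rw [run_seq, run_setFld, run_setFld]
    constructor
    · intro k hk i a b
      simp only [NExp.eval, FExp.eval, h9, Store.setFld_nat]
      have hlt : a < t + 1 ↔ a = t ∨ a < t := by omega
      have hfin : (if i = 0 ∧ a = t ∧ b = t then (1 : 𝕜) else s'.fld k i a b) =
          if i = 0 ∧ a = b ∧ a < t + 1 then 1 else 0 := by
        rw [hI k hk]
        by_cases h1 : i = 0 ∧ a = t ∧ b = t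
        · rw [if_pos h1, if_pos ⟨h1.1, by omega, by omega⟩]
        · rw [if_neg h1]
          refine if_congr ⟨fun h => ⟨h.1, h.2.1, by omega⟩, fun h => ⟨h.1, h.2.1, ?_⟩⟩ rfl rfl
          have : ¬a = t := fun h' => h1 ⟨h.1, h', by omega⟩
          omega
      rw [← hfin]
      rcases hk with rfl | rfl
      · rw [Store.setFld_fld_of_ne _ (by simp), Store.setFld_fld_self]
      · rw [Store.setFld_fld_self, Store.setFld_fld_of_ne _ (by simp)]
    · simp [NExp.cost, FExp.cost]

/-- The words of a matrix tuple, and their values. -/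
def Prog.basis : Prog := seq setup (loop 5 (.var 4) Prog.basisPass)

/-- The loop always runs `d²` passes; those after stabilization leave the list unchanged. With `n
d²` candidates of cost `d⁴` per pass this gives `n d⁸`. -/
theorem Prog.run_basis (hd1 : 1 ≤ d) (r : ℕ) (A : Fin n → Matrix (Fin d) (Fin d) 𝕜) :
    (basis.run (inputStore r A)).1.Represents A (basisWords A) ∧
      (basis.run (inputStore r A)).2 ≤ 200 * d ^ 2 + 1010 * (n * d ^ 8) := by
  obtain ⟨h0, h4, c0⟩ := run_setup r A
  rw [basis, run_seq]
  generalize setup.run (inputStore r A) = r0 at *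
  have key := run_loop_of_invariant 5 (.var 4) Prog.basisPass r0.1 h4
    (fun t s' => s'.Represents A ((_root_.basisPass A)^[t] [[]])) (20 + n * (1010 * d ^ 6)) h0
    (fun t s' v h => h.congr (fun k hk => Store.setNat_nat_of_ne _ (by omega) _ _ _ _) rfl rfl rfl)
    ?_
  · rw [iterate_basisPass_eq_basisWords A hd1] at key
    refine ⟨key.1, ?_⟩
    have h1 := key.2
    simp only [NExp.cost] at h1 ⊢
    have h2 : d * d * (20 + n * (1010 * d ^ 6) + 1) = 21 * d ^ 2 + 1010 * (n * d ^ 8) := by ring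
    have h3 : d ≤ d ^ 2 := Nat.le_self_pow (by omega) d
    have h4 : 1 ≤ d ^ 2 := Nat.one_le_pow _ _ hd1
    omega
  · intro t _ s' _ _ hI
    rw [Function.iterate_succ_apply']
    exact run_basisPass hI (iterate_basisPass A hd1 t) hd1

/-- Put the traces `tr (X i)ᴴ * Y j` into the array `k`, for the matrices `X i` that the words
have as values, and the matrices `Y j` in the array `kb`. -/
def Prog.traceTable (k kb : ℕ) (e : NExp) : Prog :=
  loop 6 (.var 1) (loop 7 e (seq (traceMul 8 4 (.var 6) kb (.var 7))
    (setFld k (.var 6) (.var 7) (.const 0) (.var 8))))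

theorem Prog.natWrites_traceTable (k kb : ℕ) (e : NExp) :
    (traceTable k kb e).natWrites = [6, 7, 9, 10] := rfl

theorem Prog.fldWrites_traceTable (k kb : ℕ) (e : NExp) :
    (traceTable k kb e).fldWrites = [8, 8, k] := rfl

theorem Prog.run_traceTable (s : Store 𝕜) (hd : s.nat 0 1 0 0 = d) (hd1 : 1 ≤ d) {k kb m N : ℕ}
    {e : NExp} (hm : s.nat 1 0 0 0 = m) (hk4 : k ≠ 4) (hkb : k ≠ kb) (hk8 : k ≠ 8) (hkb8 : kb ≠ 8)
    (he : ∀ s' : Store 𝕜, (∀ l ≤ 1, s'.nat l = s.nat l) → e.eval s' = N) (hce : e.cost ≤ 4) :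
    (∀ i < m, ∀ j < N, ((traceTable k kb e).run s).1.fld k i j 0 =
      ((s.mat d 4 i)ᴴ * s.mat d kb j).trace) ∧
      ((traceTable k kb e).run s).2 ≤ 5 + m * (6 + N * (115 * d ^ 2)) := by
  have h2 : 1 ≤ d ^ 2 := Nat.one_le_pow _ _ hd1
  have key := run_loop_of_invariant 6 (.var 1) (loop 7 e (seq (traceMul 8 4 (.var 6) kb (.var 7))
    (setFld k (.var 6) (.var 7) (.const 0) (.var 8)))) s hm
    (fun a s' => ∀ i < a, ∀ j < N, s'.fld k i j 0 = ((s.mat d 4 i)ᴴ * s.mat d kb j).trace)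
    (5 + N * (115 * d ^ 2)) (by simp) (fun _ _ _ h => h) ?_
  · refine ⟨key.1, key.2.trans (le_of_eq ?_)⟩
    simp only [NExp.cost]
    ring
  · intro a ha s1 hfr1 h6 hI
    have hn1 : ∀ l, l ≠ 6 → l ≠ 7 → l ≠ 9 → l ≠ 10 → s1.nat l = s.nat l :=
      fun l hl1 hl2 hl3 hl4 => hfr1.nat l (by
        change _ ∉ (traceTable k kb e).natWrites
        simp [natWrites_traceTable, hl1, hl2, hl3, hl4])
    have hf1 : ∀ l, l ≠ 8 → l ≠ k → s1.fld l = s.fld l := fun l hl hl' => hfr1.fld l (by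
      change _ ∉ (traceTable k kb e).fldWrites
      simp [fldWrites_traceTable, hl, hl'])
    have key := run_loop_of_invariant 7 e (seq (traceMul 8 4 (.var 6) kb (.var 7))
      (setFld k (.var 6) (.var 7) (.const 0) (.var 8))) s1
      (he s1 fun l hl => hn1 l (by omega) (by omega) (by omega) (by omega))
      (fun b s' => (∀ i < a, ∀ j < N, s'.fld k i j 0 =
          ((s.mat d 4 i)ᴴ * s.mat d kb j).trace) ∧
        ∀ j < b, s'.fld k a j 0 = ((s.mat d 4 a)ᴴ * s.mat d kb j).trace)
      (100 * d ^ 2 + 14) ⟨hI, by simp⟩ (fun _ _ _ h => h) ?_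
    · refine ⟨fun i hi j hj => ?_, key.2.trans ?_⟩
      · rcases Nat.lt_succ_iff_lt_or_eq.1 hi with h | rfl
        · exact key.1.1 i h j hj
        · exact key.1.2 j hj
      · have : N * (100 * d ^ 2 + 14 + 1) ≤ N * (115 * d ^ 2) := Nat.mul_le_mul_left _ (by omega)
        omega
    · intro b hb s2 hfr2 h7 hI2
      have hn2 : ∀ l, l ≠ 7 → l ≠ 9 → l ≠ 10 → s2.nat l = s1.nat l :=
        fun l hl1 hl2 hl3 => hfr2.nat l (by simp [natWrites, natWrites_traceMul, hl1, hl2, hl3])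
      have hf2 : ∀ l, l ≠ 8 → l ≠ k → s2.fld l = s1.fld l := fun l hl hl' => hfr2.fld l (by
        simp [fldWrites, fldWrites_traceMul, hl, hl'])
      have h6' : s2.nat 6 0 0 0 = a := by rw [hn2 6 (by simp) (by simp) (by simp), h6]
      rw [run_seq, run_setFld]
      obtain ⟨e1, c1⟩ := run_traceMul s2 (d := d)
        (by rw [hn2 0 (by simp) (by simp) (by simp), hn1 0 (by simp) (by simp) (by simp) (by simp),
          hd]) hd1 (acc := 8) (ka := 4) (kb := kb) (ia := .var 6) (ib := .var 7) (i := a) (j := b)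
        (by simp) hkb8
        (fun s' hs' => by rw [NExp.eval_var, hs' 6 (by simp) (by simp), h6'])
        (fun s' hs' => by rw [NExp.eval_var, hs' 7 (by simp) (by simp), h7])
        (by simp [NExp.cost]) (by simp [NExp.cost])
      have n3 : ∀ l, l ≠ 9 → l ≠ 10 → ((traceMul 8 4 (.var 6) kb (.var 7)).run s2).1.nat l =
          s2.nat l := fun l hl hl' => run_nat _ _ (by simp [natWrites_traceMul, hl, hl'])
      have f3 : ((traceMul 8 4 (.var 6) kb (.var 7)).run s2).1.fld k = s2.fld k :=
        run_fld _ _ (by simp [fldWrites_traceMul, hk8])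
      generalize (traceMul 8 4 (.var 6) kb (.var 7)).run s2 = r at *
      have q4 : s2.mat d 4 a = s.mat d 4 a := Store.mat_congr (by
        rw [hf2 4 (by simp) (by omega), hf1 4 (by simp) (by omega)])
      have qb : s2.mat d kb b = s.mat d kb b := Store.mat_congr (by
        rw [hf2 kb hkb8 (by omega), hf1 kb hkb8 (by omega)])
      rw [q4, qb] at e1
      simp only [NExp.eval, FExp.eval, n3 6 (by simp) (by simp), n3 7 (by simp) (by simp), h6', h7,
        e1, Store.setFld_fld_self, f3]
      refine ⟨⟨fun i hi j hj => ?_, fun j hj => ?_⟩, ?_⟩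
      · rw [if_neg (by omega)]
        exact hI2.1 i hi j hj
      · rcases Nat.lt_succ_iff_lt_or_eq.1 hj with h | rfl
        · rw [if_neg (by omega)]
          exact hI2.2 j h
        · simp
      · simp only [NExp.cost, FExp.cost]
        omega

/-- Put the traces `tr (X i)ᴴ * X j * X k` into the array `2`, for the matrices `X i` that the words
have as values. -/
def Prog.traceCube : Prog :=
  loop 6 (.var 1) (loop 7 (.var 1) (seq (mulMat 4 (.var 6) 4 (.var 7))
    (loop 8 (.var 1) (seq (traceMul 8 4 (.var 8) 6 (.const 0))
      (setFld 2 (.var 8) (.var 6) (.var 7) (.var 8))))))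

theorem Prog.natWrites_traceCube : traceCube.natWrites = [6, 7, 9, 10, 11, 8, 9, 10] := rfl

theorem Prog.fldWrites_traceCube : traceCube.fldWrites = [6, 6, 8, 8, 2] := rfl

/-- The starred factor is in the innermost loop, so the product of the other two is computed once
per pair. With `m ≤ d²` this is `d⁷` for the products and `d⁸` for the traces. -/
theorem Prog.run_traceCube (s : Store 𝕜) (hd : s.nat 0 1 0 0 = d) (hd1 : 1 ≤ d) {m : ℕ}
    (hm : s.nat 1 0 0 0 = m) :
    (∀ i < m, ∀ j < m, ∀ k < m, (traceCube.run s).1.fld 2 i j k =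
      ((s.mat d 4 i)ᴴ * s.mat d 4 j * s.mat d 4 k).trace) ∧
      (traceCube.run s).2 ≤ 5 + m * (6 + m * (100 * d ^ 3 + 6 + m * (118 * d ^ 2))) := by
  have h2 : 1 ≤ d ^ 2 := Nat.one_le_pow _ _ hd1
  let F : ℕ → ℕ → ℕ → 𝕜 := fun i j k => ((s.mat d 4 i)ᴴ * s.mat d 4 j * s.mat d 4 k).trace
  change (∀ i < m, ∀ j < m, ∀ k < m, (traceCube.run s).1.fld 2 i j k = F i j k) ∧ _
  have key := run_loop_of_invariant 6 (.var 1)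
    (loop 7 (.var 1) (seq (mulMat 4 (.var 6) 4 (.var 7))
      (loop 8 (.var 1) (seq (traceMul 8 4 (.var 8) 6 (.const 0))
        (setFld 2 (.var 8) (.var 6) (.var 7) (.var 8)))))) s hm
    (fun a s' => ∀ i < m, ∀ j < a, ∀ k < m, s'.fld 2 i j k = F i j k)
    (5 + m * (100 * d ^ 3 + 6 + m * (118 * d ^ 2))) (by simp) (fun _ _ _ h => h) ?_
  · refine ⟨key.1, key.2.trans (le_of_eq ?_)⟩
    simp only [NExp.cost]
    ring
  · intro a ha s1 hfr1 h6 hI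
    have hn1 : ∀ l, l ≠ 6 → l ≠ 7 → l ≠ 8 → l ≠ 9 → l ≠ 10 → l ≠ 11 → s1.nat l = s.nat l :=
      fun l hl1 hl2 hl3 hl4 hl5 hl6 => hfr1.nat l (by
        change _ ∉ traceCube.natWrites
        simp [natWrites_traceCube, hl1, hl2, hl3, hl4, hl5, hl6])
    have hf1 : ∀ l, l ≠ 6 → l ≠ 8 → l ≠ 2 → s1.fld l = s.fld l := fun l hl hl' hl2 =>
      hfr1.fld l (by
        change _ ∉ traceCube.fldWrites
        simp [fldWrites_traceCube, hl, hl', hl2])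
    have hm1 : (NExp.var 1).eval s1 = m := by
      rw [NExp.eval_var, hn1 1 (by simp) (by simp) (by simp) (by simp) (by simp) (by simp), hm]
    have key := run_loop_of_invariant 7 (.var 1) (seq (mulMat 4 (.var 6) 4 (.var 7))
      (loop 8 (.var 1) (seq (traceMul 8 4 (.var 8) 6 (.const 0))
        (setFld 2 (.var 8) (.var 6) (.var 7) (.var 8))))) s1 hm1
      (fun b s' => (∀ i < m, ∀ j < a, ∀ k < m, s'.fld 2 i j k = F i j k) ∧
        ∀ i < m, ∀ k < b, s'.fld 2 i a k = F i a k)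
      (100 * d ^ 3 + 5 + m * (118 * d ^ 2)) ⟨hI, by simp⟩ (fun _ _ _ h => h) ?_
    · refine ⟨fun i hi j hj k hk => ?_, key.2.trans (le_of_eq ?_)⟩
      · rcases Nat.lt_succ_iff_lt_or_eq.1 hj with h | rfl
        · exact key.1.1 i hi j h k hk
        · exact key.1.2 i hi k hk
      · simp only [NExp.cost]
        ring
    · intro b hb s2 hfr2 h7 hI2
      have hn2 : ∀ l, l ≠ 7 → l ≠ 8 → l ≠ 9 → l ≠ 10 → l ≠ 11 → s2.nat l = s1.nat l :=
        fun l hl1 hl2 hl3 hl4 hl5 => hfr2.nat l (by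
          simp [natWrites, natWrites_traceMul, natWrites_mulMat, hl1, hl2, hl3, hl4, hl5])
      have hf2 : ∀ l, l ≠ 6 → l ≠ 8 → l ≠ 2 → s2.fld l = s1.fld l := fun l hl hl' hl2 =>
        hfr2.fld l (by simp [fldWrites, fldWrites_traceMul, fldWrites_mulMat, hl, hl', hl2])
      have h6' : s2.nat 6 0 0 0 = a := by
        rw [hn2 6 (by simp) (by simp) (by simp) (by simp) (by simp), h6]
      have hd2 : s2.nat 0 1 0 0 = d := by
        rw [hn2 0 (by simp) (by simp) (by simp) (by simp) (by simp),
          hn1 0 (by simp) (by simp) (by simp) (by simp) (by simp) (by simp), hd]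
      have q2 : ∀ i, s2.mat d 4 i = s.mat d 4 i := fun i => Store.mat_congr (by
        rw [hf2 4 (by simp) (by simp) (by simp), hf1 4 (by simp) (by simp) (by simp)])
      rw [run_seq]
      obtain ⟨e1, c1⟩ := run_mulMat s2 hd2 hd1 (ka := 4) (kb := 4) (ia := .var 6) (ib := .var 7)
        (i := a) (j := b) (by simp) (by simp)
        (fun s' hs' => by rw [NExp.eval_var, hs' 6 (by simp) (by simp) (by simp), h6'])
        (fun s' hs' => by rw [NExp.eval_var, hs' 7 (by simp) (by simp) (by simp), h7])
        (by simp [NExp.cost]) (by simp [NExp.cost])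
      rw [q2, q2] at e1
      have n3 : ∀ l, l ≠ 9 → l ≠ 10 → l ≠ 11 →
          ((mulMat 4 (.var 6) 4 (.var 7)).run s2).1.nat l = s2.nat l := fun l hl1 hl2 hl3 =>
        run_nat _ _ (by simp [natWrites_mulMat, hl1, hl2, hl3])
      have f3 : ∀ l, l ≠ 6 → ((mulMat 4 (.var 6) 4 (.var 7)).run s2).1.fld l = s2.fld l :=
        fun l hl => run_fld _ _ (by simp [fldWrites_mulMat, hl])
      generalize (mulMat 4 (.var 6) 4 (.var 7)).run s2 = r1 at *
      have hm3 : (NExp.var 1).eval r1.1 = m := by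
        rw [NExp.eval_var, n3 1 (by simp) (by simp) (by simp),
          hn2 1 (by simp) (by simp) (by simp) (by simp) (by simp)]
        exact hm1
      have key := run_loop_of_invariant 8 (.var 1) (seq (traceMul 8 4 (.var 8) 6 (.const 0))
        (setFld 2 (.var 8) (.var 6) (.var 7) (.var 8))) r1.1 hm3
        (fun c s' => ((∀ i < m, ∀ j < a, ∀ k < m, s'.fld 2 i j k = F i j k) ∧
            ∀ i < m, ∀ k < b, s'.fld 2 i a k = F i a k) ∧
          -- The innermost loop fills the table along its first index, with the last two fixed at
          -- `(a, b)`.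
          ∀ i < c, s'.fld 2 i a b = F i a b)
        (100 * d ^ 2 + 17) ⟨by rw [f3 2 (by simp)]; exact hI2, by simp⟩ (fun _ _ _ h => h) ?_
      · refine ⟨⟨key.1.1.1, fun i hi k hk => ?_⟩, ?_⟩
        · rcases Nat.lt_succ_iff_lt_or_eq.1 hk with h | rfl
          · exact key.1.1.2 i hi k h
          · exact key.1.2 i hi
        · have h3 := key.2
          have : m * (100 * d ^ 2 + 17 + 1) ≤ m * (118 * d ^ 2) :=
            Nat.mul_le_mul_left _ (by omega)
          simp only [NExp.cost] at h3 ⊢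
          omega
      · intro c hc s4 hfr4 h8 hI4
        have hn4 : ∀ l, l ≠ 8 → l ≠ 9 → l ≠ 10 → s4.nat l = r1.1.nat l :=
          fun l hl1 hl2 hl3 => hfr4.nat l (by
            simp [natWrites, natWrites_traceMul, hl1, hl2, hl3])
        have hf4 : ∀ l, l ≠ 8 → l ≠ 2 → s4.fld l = r1.1.fld l := fun l hl hl' =>
          hfr4.fld l (by simp [fldWrites, fldWrites_traceMul, hl, hl'])
        have g6 : s4.nat 6 0 0 0 = a := by
          rw [hn4 6 (by simp) (by simp) (by simp), n3 6 (by simp) (by simp) (by simp), h6']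
        have g7 : s4.nat 7 0 0 0 = b := by
          rw [hn4 7 (by simp) (by simp) (by simp), n3 7 (by simp) (by simp) (by simp), h7]
        rw [run_seq, run_setFld]
        obtain ⟨e5, c5⟩ := run_traceMul s4 (d := d)
          (by rw [hn4 0 (by simp) (by simp) (by simp), n3 0 (by simp) (by simp) (by simp), hd2])
          hd1 (acc := 8) (ka := 4) (kb := 6) (ia := .var 8) (ib := .const 0) (i := c) (j := 0)
          (by simp) (by simp)
          (fun s' hs' => by rw [NExp.eval_var, hs' 8 (by simp) (by simp), h8])
          (fun _ _ => rfl) (by simp [NExp.cost]) (by simp [NExp.cost])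
        have n5 : ∀ l, l ≠ 9 → l ≠ 10 → ((traceMul 8 4 (.var 8) 6 (.const 0)).run s4).1.nat l =
            s4.nat l := fun l hl hl' => run_nat _ _ (by simp [natWrites_traceMul, hl, hl'])
        have f5 : ((traceMul 8 4 (.var 8) 6 (.const 0)).run s4).1.fld 2 = s4.fld 2 :=
          run_fld _ _ (by simp [fldWrites_traceMul])
        generalize (traceMul 8 4 (.var 8) 6 (.const 0)).run s4 = r5 at *
        have q4 : s4.mat d 4 c = s.mat d 4 c := by
          rw [← q2]
          exact Store.mat_congr (by rw [hf4 4 (by simp) (by simp), f3 4 (by simp)])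
        have q6 : s4.mat d 6 0 = s.mat d 4 a * s.mat d 4 b := by
          rw [← e1]
          exact Store.mat_congr (by rw [hf4 6 (by simp) (by simp)])
        rw [q4, q6, ← mul_assoc] at e5
        change _ = F c a b at e5
        simp only [NExp.eval, FExp.eval, n5 6 (by simp) (by simp), n5 7 (by simp) (by simp),
          n5 8 (by simp) (by simp), g6, g7, h8, e5, Store.setFld_fld_self, f5]
        refine ⟨⟨⟨fun i hi j hj k hk => ?_, fun i hi k hk => ?_⟩, fun i hi => ?_⟩, ?_⟩
        · rw [if_neg (by omega)]
          exact hI4.1.1 i hi j hj k hk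
        · rw [if_neg (by omega)]
          exact hI4.1.2 i hi k hk
        · rcases Nat.lt_succ_iff_lt_or_eq.1 hi with h | rfl
          · rw [if_neg (by omega)]
            exact hI4.2 i h
          · simp
        · simp only [NExp.cost, FExp.cost]
          omega

/-- The program that computes the trace data. -/
def Prog.traceData : Prog :=
  seq basis (seq (traceTable 1 4 (.var 1)) (seq (traceTable 3 0 (.var 0)) traceCube))

theorem Prog.run_traceData (hn1 : 1 ≤ n) (hd1 : 1 ≤ d) (r : ℕ)
    (A : Fin n → Matrix (Fin d) (Fin d) 𝕜) :
    (Prog.traceData.run (inputStore r A)).1.Holds (_root_.traceData A) ∧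
      (Prog.traceData.run (inputStore r A)).2 ≤ 2000 * (n * d ^ 8) := by
  have hlen : (basisWords A).length ≤ d ^ 2 :=
    (isShortIndependent_basisWords A hd1).length_le.trans (le_of_eq (sq d).symm)
  obtain ⟨h0, c0⟩ := run_basis hd1 r A
  rw [Prog.traceData, run_seq, run_seq, run_seq]
  generalize basis.run (inputStore r A) = r0 at *
  obtain ⟨e1, c1⟩ := run_traceTable r0.1 h0.dim hd1 (k := 1) (kb := 4) (e := .var 1) h0.count
    (by simp) (by simp) (by simp) (by simp)
    (fun s' hs' => by rw [NExp.eval_var, hs' 1 (by simp), h0.count]) (by simp [NExp.cost])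
  have n1 : ∀ k ≤ 3, ((traceTable 1 4 (.var 1)).run r0.1).1.nat k = r0.1.nat k := fun k hk =>
    run_nat _ _ (by rw [natWrites_traceTable]; simp; omega)
  have f1 : ∀ k, k ≠ 1 → k ≠ 8 → ((traceTable 1 4 (.var 1)).run r0.1).1.fld k = r0.1.fld k :=
    fun k hk hk' => run_fld _ _ (by simp [fldWrites_traceTable, hk, hk'])
  generalize (traceTable 1 4 (.var 1)).run r0.1 = r1 at *
  have h1 : r1.1.Represents A (basisWords A) := h0.congr n1 (f1 0 (by simp) (by simp))
    (f1 4 (by simp) (by simp)) (f1 5 (by simp) (by simp))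
  obtain ⟨e2, c2⟩ := run_traceTable r1.1 h1.dim hd1 (k := 3) (kb := 0) (e := .var 0) h1.count
    (by simp) (by simp) (by simp) (by simp)
    (fun s' hs' => by rw [NExp.eval_var, hs' 0 (by simp), h1.num]) (by simp [NExp.cost])
  have n2 : ∀ k ≤ 3, ((traceTable 3 0 (.var 0)).run r1.1).1.nat k = r1.1.nat k := fun k hk =>
    run_nat _ _ (by rw [natWrites_traceTable]; simp; omega)
  have f2 : ∀ k, k ≠ 3 → k ≠ 8 → ((traceTable 3 0 (.var 0)).run r1.1).1.fld k = r1.1.fld k :=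
    fun k hk hk' => run_fld _ _ (by simp [fldWrites_traceTable, hk, hk'])
  generalize (traceTable 3 0 (.var 0)).run r1.1 = r2 at *
  have h2 : r2.1.Represents A (basisWords A) := h1.congr n2 (f2 0 (by simp) (by simp))
    (f2 4 (by simp) (by simp)) (f2 5 (by simp) (by simp))
  obtain ⟨e3, c3⟩ := run_traceCube r2.1 h2.dim hd1 h2.count
  have n3 : ∀ k ≤ 3, (traceCube.run r2.1).1.nat k = r2.1.nat k := fun k hk =>
    run_nat _ _ (by rw [natWrites_traceCube]; simp; omega)
  have f3 : ∀ k, k ≠ 2 → k ≠ 6 → k ≠ 8 → (traceCube.run r2.1).1.fld k = r2.1.fld k :=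
    fun k hk hk' hk2 => run_fld _ _ (by simp [fldWrites_traceCube, hk, hk', hk2])
  generalize traceCube.run r2.1 = r3 at *
  have h3 : r3.1.Represents A (basisWords A) := h2.congr n3 (f3 0 (by simp) (by simp) (by simp))
    (f3 4 (by simp) (by simp) (by simp)) (f3 5 (by simp) (by simp) (by simp))
  constructor
  · refine ⟨h3.count, fun j => h3.length j j.2, fun j p => h3.letter j j.2 p p.2, fun i j => ?_,
      fun i j k => ?_, fun i j => ?_⟩
    · rw [f3 1 (by simp) (by simp) (by simp), f2 1 (by simp) (by simp), e1 i i.2 j j.2,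
        h0.value i i.2, h0.value j j.2]
      rfl
    · rw [e3 i i.2 j j.2 k k.2, h2.value i i.2, h2.value j j.2, h2.value k k.2]
      rfl
    · rw [f3 3 (by simp) (by simp) (by simp), e2 i i.2 j j.2, h1.value i i.2, h1.input]
      rfl
  · simp only
    generalize (basisWords A).length = m at *
    have p2 : 1 ≤ d ^ 2 := Nat.one_le_pow _ _ hd1
    have p4 : d ^ 4 ≤ d ^ 8 := Nat.pow_le_pow_right hd1 (by omega)
    have p6 : d ^ 6 ≤ d ^ 8 := Nat.pow_le_pow_right hd1 (by omega)
    have p7 : d ^ 7 ≤ d ^ 8 := Nat.pow_le_pow_right hd1 (by omega)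
    have p28 : d ^ 2 ≤ d ^ 8 := Nat.pow_le_pow_right hd1 (by omega)
    -- Here `n ≥ 1` absorbs the terms without a factor `n`, in particular the cost of the triple
    -- traces.
    have q8 : d ^ 8 ≤ n * d ^ 8 := Nat.le_mul_of_pos_left _ hn1
    have q4 : n * d ^ 4 ≤ n * d ^ 8 := Nat.mul_le_mul_left _ p4
    have b1 : m * (6 + m * (115 * d ^ 2)) ≤ 6 * d ^ 2 + 115 * d ^ 6 := by
      calc m * (6 + m * (115 * d ^ 2)) ≤ d ^ 2 * (6 + d ^ 2 * (115 * d ^ 2)) := by gcongr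
        _ = _ := by ring
    have b2 : m * (6 + n * (115 * d ^ 2)) ≤ 6 * d ^ 2 + 115 * (n * d ^ 4) := by
      calc m * (6 + n * (115 * d ^ 2)) ≤ d ^ 2 * (6 + n * (115 * d ^ 2)) := by gcongr
        _ = _ := by ring
    have b3 : m * (6 + m * (100 * d ^ 3 + 6 + m * (118 * d ^ 2))) ≤
        6 * d ^ 2 + 100 * d ^ 7 + 6 * d ^ 4 + 118 * d ^ 8 := by
      calc m * (6 + m * (100 * d ^ 3 + 6 + m * (118 * d ^ 2)))
          ≤ d ^ 2 * (6 + d ^ 2 * (100 * d ^ 3 + 6 + d ^ 2 * (118 * d ^ 2))) := by gcongr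
        _ = _ := by ring
    omega

end TraceProgram

/-! ### The main theorem. -/

theorem mainTheorem3 :
    ∃ (P : Prog) (C : ℕ), ∀ (𝕜 : Type*) [RCLike 𝕜] (n d r : ℕ), 1 ≤ n → 1 ≤ d →
      IsInjectiveInvariant (Matrix.unitaryGroup (Fin d) 𝕜)
        (projInvariant : (Fin n → Gr 𝕜 r d) → TraceData 𝕜 n) ∧
      ∀ V : Fin n → Gr 𝕜 r d,
        (P.run (inputStore r fun i => (V i).projMatrix)).1.Holds (projInvariant V) ∧
        (P.run (inputStore r fun i => (V i).projMatrix)).2 ≤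
          C * (n * d ^ 8 + r ^ 2 * d ^ 9) := by
  refine ⟨Prog.traceData, 2000, fun 𝕜 _ n d r hn hd =>
    ⟨isInjectiveInvariant_projInvariant hd, fun V => ?_⟩⟩
  have h := Prog.run_traceData hn hd r fun i => (V i).projMatrix
  refine ⟨h.1, h.2.trans ?_⟩
  -- The run is already bounded by `2000 * (n * d ^ 8)`; the second term of the stated bound is
  -- slack.
  rw [mul_add]
  exact Nat.le_add_right _ _
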